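/- **Setting.** Let $\mathcal X,\mathcal A$ be finite, let $P(x'\mid a,x)$ be the transition kernel of a Markov decision process with reward $r:\mathcal X\times\mathcal A\to\mathbb R$ (bounded, since $\mathcal X\times\mathcal A$ is finite), and let $\pi(a\mid x)$ be a stationary policy. Assume that the state chain with transition matrix $P_\pi(x'\mid x)=\sum_a P(x'\mid a,x)\pi(a\mid x)$ is irreducible and aperiodic, with unique steady-state distribution $\mu$, and $\mu(x)>0$ for all $x$. Let $x_1\sim\mu$, $a_n\sim\pi(\cdot\mid x_n)$, $x_{n+1}\sim P(\cdot\mid a_n,x_n)$, $n\ge 1$. Let $\phi:\mathcal X\to\mathbb R^d$ satisfy $\|\phi(x)\|\le 1$ for all $x$, and let the matrix $\Phi$ with rows $\phi(x)^\top$ have full column rank. Write $\phi_n=\phi(x_n)$, $r_n=r(x_n,a_n)$, and let $\lambda_{\min}$ be the smallest eigenvalue of $\sum_x\mu(x)\phi(x)\phi(x)^\top$. Let $\gamma\in(0,1)$, $\lambda\in[0,1]$, $\kappa=\frac{\gamma(1-\lambda)}{1-\lambda\gamma}$. Let $w_*\in\mathbb R^d$ solve $$\mathbb E_\infty\big[e_{-\infty:n}\phi_n^\top-\gamma\,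 e_{-\infty:n}\phi_{n+1}^\top\big]w_*=\mathbb E_\infty[r_n e_{-\infty:n}],\qquad e_{-\infty:n}=\sum_{k\ge0}(\lambda\gamma)^k\phi_{n-k},$$ where $\mathbb E_\infty$ is expectation in steady state. **Algorithm.** For $R\ge\|w_*\|$ let $\Pi_R(w)=Rw/\|w\|$ if $\|w\|>R$ and $\Pi_R(w)=w$ otherwise. Projected implicit TD($\lambda$) with step sizes $\alpha_n$ and initial guess $w_1\in\mathbb R^d$ is $$w_{n+1}=\Pi_R\Big(w_n+\frac{\alpha_n}{1+\alpha_n\|e_n\|^2}\,(r_n+\gamma\phi_{n+1}^\top w_n-\phi_n^\top w_n)\,e_n\Big),\quad e_n=\phi_n+\lambda\gamma e_{n-1},\ e_0=0,\quad n\ge 1.$$ **Mixing time.** Call $(m,\rho)$, with $m>0$ and $\rho\in(0,1)$, mixing constants if $\sup_x d_{TV}(\mathbb P(x_n\in\cdot\mid x_1=x),\mu)\le m\rho^n$ for all $n\ge1$, and put $\tau_\epsilon=\min\{n\ge1: m\rho^n\le\epsilon\}$. **Theorem.** Let $\alpha_1>0$ and $\alpha_n=\dfrac{\alpha_1}{\alpha_1\lambda_{\min}(1-\kappa)(n-1)+1}$.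 Then mixing constants exist, every $\|w_{N+1}-w_*\|^2$ is integrable, and $$\mathbb E\|w_{N+1}-w_*\|^2=\tilde O(1/N)\quad\text{for } N>2\tau_{\alpha_N},$$ that is, there are $C\in\mathbb R$ and $k\in\mathbb N$ such that, for all mixing constants $(m,\rho)$ and all $N>2\tau_{\alpha_N}$, $\ \mathbb E\|w_{N+1}-w_*\|^2\le C(\log N)^k/N$. In particular, $\mathbb E\|w_{N+1}-w_*\|^2\to0$ as $N\to\infty$. -/

import Mathlib

open MeasureTheory Filter Topology
open scoped RealInnerProductSpace

namespace ImplicitTD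

/-- A Markov decision process with finite state space `S` and finite action space `A`:
`P a x x'` is the probability of moving to `x'` when action `a` is taken in state `x`,
and `r x a` is the reward (automatically bounded, since `S` and `A` are finite). -/
structure MDP (S A : Type*) [Fintype S] where
  P : A → S → S → ℝ
  P_nonneg : ∀ a x x', 0 ≤ P a x x'
  P_sum : ∀ a x, ∑ x', P a x x' = 1
  r : S → A → ℝ

/-- A stationary (possibly randomized) policy: `prob x a` is the probability of action `a`
in state `x`. -/
structure Policy (S A : Type*) [Fintype A] where
  prob : S → A → ℝ
  nonneg : ∀ x a, 0 ≤ prob x a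
  sum_one : ∀ x, ∑ a, prob x a = 1

section Chain

variable {S A : Type*} [Fintype S] [Fintype A]

/-- The transition matrix `P_π(x' | x) = ∑ a, P(x' | a, x) π(a | x)` of the state chain. -/
def transition (M : MDP S A) (π : Policy S A) : Matrix S S ℝ :=
  Matrix.of fun x x' => ∑ a, M.P a x x' * π.prob x a

/-- `μ` is a probability vector which is invariant under `K`. -/
structure IsSteadyState (K : Matrix S S ℝ) (μ : S → ℝ) : Prop where
  nonneg : ∀ x, 0 ≤ μ x
  sum_one : ∑ x, μ x = 1
  invariant : ∀ y, ∑ x, μ x * K x y = μ y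

/-- Every state has period one: the only common divisor of its possible return times is `1`. -/
def IsAperiodic [DecidableEq S] (K : Matrix S S ℝ) : Prop :=
  ∀ x, ∀ p : ℕ, (∀ n : ℕ, 1 ≤ n → 0 < (K ^ n) x x → p ∣ n) → p = 1

/-- The chain with transition matrix `K` is irreducible and aperiodic, and `μ` is its unique
steady-state distribution, with `μ x > 0` for every state `x`. -/
structure IsErgodicChain [DecidableEq S] (K : Matrix S S ℝ) (μ : S → ℝ) : Prop where
  irreducible : K.IsIrreducible
  aperiodic : IsAperiodic K
  steady : IsSteadyState K μ
  unique : ∀ ν : S → ℝ, IsSteadyState K ν → ν = μ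
  pos : ∀ x, 0 < μ x

/-- Total-variation distance between two probability vectors on a finite set. -/
noncomputable def tvDist (p q : S → ℝ) : ℝ := (∑ x, |p x - q x|) / 2

/-- `m > 0` and `ρ ∈ (0, 1)` are constants of uniform geometric ergodicity:
`sup_x d_TV(ℙ(x_n ∈ · | x_1 = x), μ) ≤ m ρ ^ n` for all `n = 1, 2, …`. The time index starts
at `1`, so the law of `x_n` given `x_1 = x` is the row `x` of `K ^ (n - 1)`. -/
structure IsMixingPair [DecidableEq S] (K : Matrix S S ℝ) (μ : S → ℝ) (m ρ : ℝ) : Prop where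
  m_pos : 0 < m
  ρ_pos : 0 < ρ
  ρ_lt_one : ρ < 1
  bound : ∀ n : ℕ, 1 ≤ n → ∀ x, tvDist ((K ^ (n - 1)) x) μ ≤ m * ρ ^ n

/-- The mixing time `τ_ε = min {n ∈ {1, 2, …} : m ρ ^ n ≤ ε}`. -/
noncomputable def mixingTime (m ρ ε : ℝ) : ℕ := sInf {n : ℕ | 1 ≤ n ∧ m * ρ ^ n ≤ ε}

/-- The processes `X 1, X 2, …` (states) and `Act 1, Act 2, …` (actions) are generated by the
policy `π` in the MDP `M`, with `X 1` distributed according to `μ`: given the past, `Act n` is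
drawn from `π(· | X n)` and then `X (n + 1)` from `P(· | Act n, X n)`. This is expressed through
the finite-dimensional distributions. (The values at index `0` are irrelevant.) -/
structure IsTrajectory {Ω : Type*} [MeasurableSpace Ω] [MeasurableSpace S] [MeasurableSpace A]
    (M : MDP S A) (π : Policy S A) (μ : S → ℝ)
    (Pr : Measure Ω) (X : ℕ → Ω → S) (Act : ℕ → Ω → A) : Prop where
  measurable_state : ∀ n, 1 ≤ n → Measurable (X n)
  measurable_action : ∀ n, 1 ≤ n → Measurable (Act n)
  law : ∀ N : ℕ, 1 ≤ N → ∀ (s : ℕ → S) (a : ℕ → A),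
    Pr.real {ω | ∀ n ∈ Finset.Icc 1 N, X n ω = s n ∧ Act n ω = a n} =
      μ (s 1) * (∏ n ∈ Finset.Icc 1 N, π.prob (s n) (a n)) *
        ∏ n ∈ Finset.Ico 1 N, M.P (a n) (s n) (s (n + 1))

end Chain

section Features

variable {S A : Type*} [Fintype S] [Fintype A] {d : ℕ}

/-- The state-feature matrix `Φ`, whose row `x` is `φ(x)ᵀ`. -/
def featureMatrix (φ : S → EuclideanSpace ℝ (Fin d)) : Matrix S (Fin d) ℝ :=
  Matrix.of fun x i => φ x i

/-- The steady-state feature covariance `Σ = Φᵀ D Φ = ∑ x, μ(x) φ(x) φ(x)ᵀ`. -/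
def featureCov [DecidableEq S] (φ : S → EuclideanSpace ℝ (Fin d)) (μ : S → ℝ) :
    Matrix (Fin d) (Fin d) ℝ :=
  (featureMatrix φ).transpose * Matrix.diagonal μ * featureMatrix φ

/-- The minimum eigenvalue `λ_min` of `Σ`. -/
noncomputable def lamMin [DecidableEq S] (φ : S → EuclideanSpace ℝ (Fin d)) (μ : S → ℝ) : ℝ :=
  sInf (spectrum ℝ (featureCov φ μ))

/-- The steady-state expectation `𝔼_∞ [f(x_n, a_n, x_{n+1}) e_{-∞:n}]`, where
`e_{-∞:n} = ∑_{k ≥ 0} (λγ)^k φ(x_{n-k})` is the steady-state eligibility trace. In the stationary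
process, `(x_{n-k}, x_n, a_n, x_{n+1})` takes the value `(x, y, a, z)` with probability
`μ(x) P_π^k(x, y) π(a | y) P(z | a, y)`. -/
noncomputable def steadyTraceMean [DecidableEq S] (M : MDP S A) (π : Policy S A) (μ : S → ℝ)
    (φ : S → EuclideanSpace ℝ (Fin d)) (γ lam : ℝ) (f : S → A → S → ℝ) :
    EuclideanSpace ℝ (Fin d) :=
  ∑' k : ℕ, (lam * γ) ^ k • ∑ x, ∑ y, ∑ a, ∑ z,
    (μ x * (transition M π ^ k) x y * π.prob y a * M.P a y z * f y a z) • φ x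

/-- `w` solves the steady-state TD(`λ`) equation
`𝔼_∞[e_{-∞:n} φ_nᵀ - γ e_{-∞:n} φ_{n+1}ᵀ] w = 𝔼_∞[r_n e_{-∞:n}]`. -/
def IsTDSolution [DecidableEq S] (M : MDP S A) (π : Policy S A) (μ : S → ℝ)
    (φ : S → EuclideanSpace ℝ (Fin d)) (γ lam : ℝ) (w : EuclideanSpace ℝ (Fin d)) : Prop :=
  steadyTraceMean M π μ φ γ lam (fun y _ z => ⟪φ y, w⟫ - γ * ⟪φ z, w⟫) =
    steadyTraceMean M π μ φ γ lam (fun y a _ => M.r y a)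

end Features

section Algorithm

variable {S A : Type*} {d : ℕ}

/-- The Euclidean projection `Π_R` onto the ball of radius `R` centred at `0`. -/
noncomputable def projBall (R : ℝ) (w : EuclideanSpace ℝ (Fin d)) : EuclideanSpace ℝ (Fin d) :=
  if R < ‖w‖ then (R / ‖w‖) • w else w

/-- The eligibility trace along a path `x` of states:
`e_0 = 0`, `e_n = φ(x_n) + λγ e_{n-1}`. -/
noncomputable def trace (φ : S → EuclideanSpace ℝ (Fin d)) (γ lam : ℝ) (x : ℕ → S) :
    ℕ → EuclideanSpace ℝ (Fin d)
  | 0 => 0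
  | n + 1 => φ (x (n + 1)) + (lam * γ) • trace φ γ lam x n

/-- One step (number `n`) of projected implicit TD(`λ`) from the current iterate `w`:
`Π_R (w + α_n / (1 + α_n ‖e_n‖²) * (r_n + γ φ_{n+1}ᵀ w - φ_nᵀ w) e_n)`. -/
noncomputable def projImplicitStep (r : S → A → ℝ) (φ : S → EuclideanSpace ℝ (Fin d))
    (γ lam R : ℝ) (α : ℕ → ℝ) (x : ℕ → S) (a : ℕ → A) (n : ℕ)
    (w : EuclideanSpace ℝ (Fin d)) : EuclideanSpace ℝ (Fin d) :=
  projBall R (w + (α n / (1 + α n * ‖trace φ γ lam x n‖ ^ 2) *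
    (r (x n) (a n) + γ * ⟪φ (x (n + 1)), w⟫ - ⟪φ (x n), w⟫)) • trace φ γ lam x n)

/-- The iterates `w_1, w_2, …` of projected implicit TD(`λ`) along the path `x_1, a_1, x_2, a_2, …`,
started from the initial guess `w₁`. (The value at index `0` is irrelevant.) -/
noncomputable def projImplicitTD (r : S → A → ℝ) (φ : S → EuclideanSpace ℝ (Fin d))
    (γ lam R : ℝ) (α : ℕ → ℝ) (w₁ : EuclideanSpace ℝ (Fin d)) (x : ℕ → S) (a : ℕ → A) :
    ℕ → EuclideanSpace ℝ (Fin d)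
  | 0 => w₁
  | 1 => w₁
  | n + 2 => projImplicitStep r φ γ lam R α x a (n + 1)
      (projImplicitTD r φ γ lam R α w₁ x a (n + 1))

/-- The contraction modulus `κ = γ (1 - λ) / (1 - λγ)`. -/
noncomputable def kappa (γ lam : ℝ) : ℝ := γ * (1 - lam) / (1 - lam * γ)

/-- The decreasing step size `α_n = α₁ / (α₁ λ_min (1 - κ) (n - 1) + 1)`, `n = 1, 2, …`, where
`l` stands for `λ_min`. -/
noncomputable def stepSize (α₁ l κ : ℝ) (n : ℕ) : ℝ :=
  α₁ / (α₁ * l * (1 - κ) * ((n : ℝ) - 1) + 1)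

end Algorithm

end ImplicitTD

/-!
The proof is a Lyapunov argument with a corrector from the Poisson equation. It yields the rate
`C / N` without logarithm, for every `N ≥ 2` (`exists_mean_sq_error_le`); the mixing time enters
only through `N > 2 τ ≥ 2`.

Write `δ_n = w_n - w_*`, `β = λγ`, `c = λ_min (1 - κ)`. Projection onto the ball does not increase
the distance to `w_*`, and the implicit step differs from the explicit one by `O(α_n²)`, so that
`‖δ_{n+1}‖² ≤ ‖δ_n‖² + 2 α_n s_n ⟪e_n, δ_n⟫ + O(α_n²)` with `s_n` the temporal difference. Were
`s_n e_n` replaced by its steady-state mean, the middle term would be at most `-2 c α_n ‖δ_n‖²`: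
this is `meanDrift_le`, which rests on `resolvent_quadratic_le` and on the TD equation for `w_*`.

The discrepancy between the update and its mean is correlated with `w_n` through the Markov noise.
For frozen `w` it has the form `Ψ(x_n, e_n, w) - 𝔼[Ψ(x_{n+1}, e_{n+1}, w) | x_n, e_n]`, where
`Ψ = corrector` solves a Poisson equation (`corrector_poisson`). As the trace obeys a linear
recursion, `Ψ` is affine in `e`: its slope is obtained by inverting `1 - βK`, its constant term by
inverting `1 - K` on functions of stationary mean zero, through the convergent series `resolvent`
and `deviation`. The second series converges by geometric ergodicity (`exists_geometric_bound`),
which is Doeblin's argument applied to a strictly positive power of the transition matrix.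

As `Ψ` is bounded, and Lipschitz in `w`, on bounded sets, and `w_{n+1} - w_n = O(α_n)`,
`α_n - α_{n+1} = O(α_n²)`, the quantity `V_n = 𝔼[‖δ_n‖² + 2 α_n Ψ(x_n, e_n, w_n)]` satisfies
`V_{n+1} ≤ (1 - 2 c α_n) V_n + O(α_n²)`. Since `1 / α_{n+1} = 1 / α_n + c`, this forces
`V_n = O(α_n)`, hence `𝔼 ‖δ_n‖² = O(α_n) = O(1 / n)`.
-/

namespace ImplicitTD

/-! ### Geometric ergodicity and the Poisson equation on a finite state space -/

section Chain

variable {S A : Type*} [Fintype S] [Fintype A] [DecidableEq S]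

lemma transition_mem_rowStochastic (M : MDP S A) (π : Policy S A) :
    transition M π ∈ Matrix.rowStochastic ℝ S := by
  rw [Matrix.mem_rowStochastic_iff_sum]
  constructor
  · intro x y
    exact Finset.sum_nonneg fun a _ => mul_nonneg (M.P_nonneg a x y) (π.nonneg x a)
  · intro x
    simp only [transition, Matrix.of_apply]
    rw [Finset.sum_comm]
    simp_rw [← Finset.sum_mul, M.P_sum, one_mul, π.sum_one]

variable {K : Matrix S S ℝ} {μ : S → ℝ}

lemma IsSteadyState.pow (hμ : IsSteadyState K μ) (n : ℕ) : IsSteadyState (K ^ n) μ := by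
  refine ⟨hμ.nonneg, hμ.sum_one, ?_⟩
  induction n with
  | zero => intro y; simp [Matrix.one_apply]
  | succ n ih =>
    intro y
    simp_rw [pow_succ, Matrix.mul_apply, Finset.mul_sum]
    rw [Finset.sum_comm]
    simp_rw [← mul_assoc, ← Finset.sum_mul, ih, hμ.invariant]

/-- The possible return times to `x` form an additive semigroup, whose greatest common divisor is
one; hence it contains all large integers. -/
lemma eventually_return_pos (hK : K ∈ Matrix.rowStochastic ℝ S) (hap : IsAperiodic K) (x : S) :
    ∃ n₀, ∀ n ≥ n₀, 0 < (K ^ n) x x := by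
  have hnn : ∀ n x y, 0 ≤ (K ^ n) x y := fun n x y =>
    Matrix.nonneg_of_mem_rowStochastic (pow_mem hK n)
  let T : AddSubmonoid ℕ :=
    { carrier := {n | 0 < (K ^ n) x x}
      zero_mem' := by simp
      add_mem' := by
        intro a b ha hb
        simp only [Set.mem_ofPred_eq] at *
        rw [pow_add, Matrix.mul_apply]
        exact lt_of_lt_of_le (mul_pos ha hb) (Finset.single_le_sum
          (f := fun z => (K ^ a) x z * (K ^ b) z x)
          (fun z _ => mul_nonneg (hnn _ _ _) (hnn _ _ _)) (Finset.mem_univ x)) }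
  obtain ⟨n₀, h⟩ := Nat.exists_mem_closure_of_ge (s := (T : Set ℕ))
  have hg : Nat.setGcd (T : Set ℕ) = 1 :=
    hap x _ fun n _ hpos => Nat.setGcd_dvd_of_mem (s := (T : Set ℕ)) hpos
  refine ⟨n₀, fun n hn => ?_⟩
  have := h n hn (by simp [hg])
  rw [AddSubmonoid.closure_eq] at this
  exact this

/-- A finite irreducible and aperiodic chain is primitive. -/
lemma exists_pow_pos (hK : K ∈ Matrix.rowStochastic ℝ S) (hirr : K.IsIrreducible)
    (hap : IsAperiodic K) : ∃ n, 0 < n ∧ ∀ x y, 0 < (K ^ n) x y := by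
  have hnn : ∀ n x y, 0 ≤ (K ^ n) x y := fun n x y =>
    Matrix.nonneg_of_mem_rowStochastic (pow_mem hK n)
  choose n₀ hn₀ using eventually_return_pos hK hap
  choose k _ hk using (Matrix.isIrreducible_iff_exists_pow_pos hirr.nonneg).1 hirr
  refine ⟨(∑ x, n₀ x) + (∑ x, ∑ y, k x y) + 1, by omega, fun x y => ?_⟩
  have h1 : n₀ x ≤ ∑ x, n₀ x := Finset.single_le_sum (fun _ _ => Nat.zero_le _) (Finset.mem_univ x)
  have h2 : k x y ≤ ∑ x, ∑ y, k x y :=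
    (Finset.single_le_sum (f := fun y => k x y) (fun _ _ => Nat.zero_le _)
      (Finset.mem_univ y)).trans
    (Finset.single_le_sum (f := fun x => ∑ y, k x y) (fun _ _ => Nat.zero_le _)
      (Finset.mem_univ x))
  obtain ⟨j, hj, e⟩ : ∃ j, n₀ x ≤ j ∧ (∑ x, n₀ x) + (∑ x, ∑ y, k x y) + 1 = j + k x y :=
    ⟨(∑ x, n₀ x) + (∑ x, ∑ y, k x y) + 1 - k x y, by omega, by omega⟩
  rw [e, pow_add, Matrix.mul_apply]
  exact lt_of_lt_of_le (mul_pos (hn₀ x j hj) (hk x y)) (Finset.single_le_sum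
    (f := fun z => (K ^ j) x z * (K ^ k x y) z y)
    (fun z _ => mul_nonneg (hnn _ _ _) (hnn _ _ _)) (Finset.mem_univ x))

/-- Doeblin's contraction: if all entries of a stochastic matrix `Q` are at least `ε` times those
of `1 μᵀ`, then `Q` contracts the `ℓ¹` norm of signed vectors of total mass zero
by the factor `1 - ε`. -/
lemma sum_abs_vecMul_le {Q : Matrix S S ℝ} (hQ : Q ∈ Matrix.rowStochastic ℝ S) {ε : ℝ}
    (hμ : ∑ x, μ x = 1) (hε : ∀ x y, ε * μ y ≤ Q x y) {ν : S → ℝ} (hν : ∑ x, ν x = 0) :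
    ∑ y, |∑ x, ν x * Q x y| ≤ (1 - ε) * ∑ x, |ν x| := by
  have h1 : ∀ y, |∑ x, ν x * Q x y| ≤ ∑ x, |ν x| * (Q x y - ε * μ y) := by
    intro y
    have : ∑ x, ν x * Q x y = ∑ x, ν x * (Q x y - ε * μ y) := by
      simp_rw [mul_sub, Finset.sum_sub_distrib, ← Finset.sum_mul, hν]; simp
    rw [this]
    refine (Finset.abs_sum_le_sum_abs _ _).trans (Finset.sum_le_sum fun x _ => ?_)
    rw [abs_mul, abs_of_nonneg (sub_nonneg.2 (hε x y))]
  refine (Finset.sum_le_sum fun y _ => h1 y).trans (le_of_eq ?_)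
  rw [Finset.sum_comm]
  simp_rw [← Finset.mul_sum, Finset.sum_sub_distrib, Matrix.sum_row_of_mem_rowStochastic hQ,
    ← Finset.mul_sum, hμ, ← Finset.sum_mul]
  ring

/-- Geometric ergodicity of a finite irreducible aperiodic chain, in `ℓ¹` form. -/
lemma exists_geometric_bound (hK : K ∈ Matrix.rowStochastic ℝ S) (hirr : K.IsIrreducible)
    (hap : IsAperiodic K) (hμ : IsSteadyState K μ) :
    ∃ m ρ : ℝ, 0 < m ∧ 0 < ρ ∧ ρ < 1 ∧ ∀ n x, ∑ y, |(K ^ n) x y - μ y| ≤ m * ρ ^ n := by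
  obtain ⟨N, hN, hpos⟩ := exists_pow_pos hK hirr hap
  have hμ1 : ∀ y, μ y ≤ 1 := fun y => by
    rw [← hμ.sum_one]; exact Finset.single_le_sum (fun x _ => hμ.nonneg x) (Finset.mem_univ y)
  obtain ⟨ε, hε0, hε1, hε⟩ : ∃ ε : ℝ, 0 < ε ∧ ε < 1 ∧ ∀ x y, ε ≤ (K ^ N) x y := by
    have hfin : (Set.range fun p : S × S => (K ^ N) p.1 p.2).Finite := Set.finite_range _
    have : ∀ᶠ ε in 𝓝[>] (0 : ℝ), ∀ p : S × S, ε ≤ (K ^ N) p.1 p.2 := by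
      rw [Filter.eventually_all]
      exact fun p => nhdsWithin_le_nhds (eventually_le_nhds (hpos p.1 p.2))
    obtain ⟨ε, h1, h2, h3⟩ := (this.and ((eventually_mem_nhdsWithin (s := Set.Ioi (0:ℝ))).and
      (nhdsWithin_le_nhds (eventually_lt_nhds (zero_lt_one (α := ℝ)))))).exists
    exact ⟨ε, h2, h3, fun x y => h1 (x, y)⟩
  have hstep : ∀ n x, ∑ y, |(K ^ (n + N)) x y - μ y| ≤
      (1 - ε) * ∑ y, |(K ^ n) x y - μ y| := by
    intro n x
    have := sum_abs_vecMul_le (μ := μ) (pow_mem hK N) hμ.sum_one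
      (fun x y => (mul_le_of_le_one_right hε0.le (hμ1 y)).trans (hε x y))
      (ν := fun y => (K ^ n) x y - μ y)
      (by rw [Finset.sum_sub_distrib, Matrix.sum_row_of_mem_rowStochastic (pow_mem hK n),
        hμ.sum_one, sub_self])
    simpa [sub_mul, Finset.sum_sub_distrib, (hμ.pow N).invariant, pow_add, Matrix.mul_apply]
      using this
  set ρ : ℝ := (1 - ε) ^ ((N : ℝ)⁻¹) with hρ
  have hρN : ρ ^ N = 1 - ε := Real.rpow_inv_natCast_pow (by linarith) hN.ne'
  have hρ0 : 0 < ρ := Real.rpow_pos_of_pos (by linarith) _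
  have hρ1 : ρ < 1 := Real.rpow_lt_one (by linarith) (by linarith) (by positivity)
  refine ⟨2 / ρ ^ N, ρ, by positivity, hρ0, hρ1, fun n => ?_⟩
  induction n using Nat.strong_induction_on with
  | _ n ih =>
    intro x
    rcases lt_or_ge n N with h | h
    · have h2 : ∑ y, |(K ^ n) x y - μ y| ≤ 2 := by
        calc ∑ y, |(K ^ n) x y - μ y| ≤ ∑ y, ((K ^ n) x y + μ y) := by
              refine Finset.sum_le_sum fun y _ => (abs_sub _ _).trans (le_of_eq ?_)
              rw [abs_of_nonneg (Matrix.nonneg_of_mem_rowStochastic (pow_mem hK n)),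
                abs_of_nonneg (hμ.nonneg y)]
          _ = 2 := by
              rw [Finset.sum_add_distrib, Matrix.sum_row_of_mem_rowStochastic (pow_mem hK n),
                hμ.sum_one]; norm_num
      refine h2.trans ?_
      rw [div_mul_eq_mul_div, le_div_iff₀ (by positivity)]
      exact mul_le_mul_of_nonneg_left (pow_le_pow_of_le_one hρ0.le hρ1.le h.le) zero_le_two
    · obtain ⟨j, rfl⟩ := Nat.exists_eq_add_of_le' h
      refine (hstep j x).trans ((mul_le_mul_of_nonneg_left (ih j (by omega) x)
        (by linarith)).trans (le_of_eq ?_))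
      rw [← hρN, pow_add]; ring

lemma IsErgodicChain.exists_isMixingPair (hK : K ∈ Matrix.rowStochastic ℝ S)
    (h : IsErgodicChain K μ) : ∃ m ρ, IsMixingPair K μ m ρ := by
  obtain ⟨m, ρ, hm, hρ0, hρ1, hb⟩ :=
    exists_geometric_bound hK h.irreducible h.aperiodic h.steady
  refine ⟨m / ρ, ρ, by positivity, hρ0, hρ1, fun n hn x => ?_⟩
  obtain ⟨j, rfl⟩ := Nat.exists_eq_add_of_le' hn
  have e : m / ρ * ρ ^ (j + 1) = m * ρ ^ j := by rw [pow_succ]; field_simp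
  have h0 : 0 ≤ m * ρ ^ j := by positivity
  rw [e, tvDist, add_tsub_cancel_right]
  linarith [hb j x]

/-- The discounted occupation kernel `∑ₖ βᵏ Kᵏ = (1 - βK)⁻¹`. -/
noncomputable def resolvent (K : Matrix S S ℝ) (β : ℝ) (x y : S) : ℝ :=
  ∑' k : ℕ, β ^ k * (K ^ k) x y

/-- The deviation kernel `∑ₖ (Kᵏ - 1 μᵀ)`, which solves the Poisson equation. -/
noncomputable def deviation (K : Matrix S S ℝ) (μ : S → ℝ) (x y : S) : ℝ :=
  ∑' k : ℕ, ((K ^ k) x y - μ y)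

lemma hasSum_resolvent (hK : K ∈ Matrix.rowStochastic ℝ S) {β : ℝ} (h0 : 0 ≤ β) (h1 : β < 1)
    (x y : S) : HasSum (fun k : ℕ => β ^ k * (K ^ k) x y) (resolvent K β x y) := by
  refine (Summable.of_nonneg_of_le (fun k => mul_nonneg (pow_nonneg h0 k)
    (Matrix.nonneg_of_mem_rowStochastic (pow_mem hK k))) (fun k => ?_)
    (summable_geometric_of_lt_one h0 h1)).hasSum
  exact mul_le_of_le_one_right (pow_nonneg h0 k) (Matrix.le_one_of_mem_rowStochastic (pow_mem hK k))

lemma resolvent_eq (hK : K ∈ Matrix.rowStochastic ℝ S) {β : ℝ} (h0 : 0 ≤ β) (h1 : β < 1)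
    (x y : S) : resolvent K β x y - β * ∑ z, K x z * resolvent K β z y =
      (1 : Matrix S S ℝ) x y := by
  have hs := hasSum_resolvent hK h0 h1
  have e1 := (hasSum_sum fun z (_ : z ∈ Finset.univ) => (hs z y).mul_left (K x z)).mul_left β
  have e2 := (hasSum_nat_add_iff' 1).2 (hs x y)
  have : (fun k : ℕ => β * ∑ z, K x z * (β ^ k * (K ^ k) z y)) =
      fun k => β ^ (k + 1) * (K ^ (k + 1)) x y := by
    funext k
    rw [pow_succ' K, Matrix.mul_apply, Finset.mul_sum, Finset.mul_sum]
    exact Finset.sum_congr rfl fun z _ => by ring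
  rw [this] at e1
  rw [e1.unique e2]; simp

lemma IsErgodicChain.hasSum_deviation (hK : K ∈ Matrix.rowStochastic ℝ S)
    (h : IsErgodicChain K μ) (x y : S) :
    HasSum (fun k : ℕ => (K ^ k) x y - μ y) (deviation K μ x y) := by
  obtain ⟨m, ρ, hm, hρ0, hρ1, hb⟩ :=
    exists_geometric_bound hK h.irreducible h.aperiodic h.steady
  refine (Summable.of_norm_bounded ((summable_geometric_of_lt_one hρ0.le hρ1).mul_left m)
    fun k => le_trans ?_ (hb k x)).hasSum
  exact Finset.single_le_sum (f := fun y => |(K ^ k) x y - μ y|) (fun _ _ => abs_nonneg _)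
    (Finset.mem_univ y)

lemma IsErgodicChain.deviation_eq (hK : K ∈ Matrix.rowStochastic ℝ S)
    (h : IsErgodicChain K μ) (x y : S) :
    deviation K μ x y - ∑ z, K x z * deviation K μ z y = (1 : Matrix S S ℝ) x y - μ y := by
  have hs := h.hasSum_deviation hK
  have e1 := hasSum_sum fun z (_ : z ∈ Finset.univ) => (hs z y).mul_left (K x z)
  have e2 := (hasSum_nat_add_iff' 1).2 (hs x y)
  have : (fun k : ℕ => ∑ z, K x z * ((K ^ k) z y - μ y)) =
      fun k => (K ^ (k + 1)) x y - μ y := by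
    funext k
    simp_rw [mul_sub, Finset.sum_sub_distrib, ← Finset.sum_mul,
      Matrix.sum_row_of_mem_rowStochastic hK, one_mul]
    rw [pow_succ' K, Matrix.mul_apply]
  rw [this] at e1
  rw [e1.unique e2]; simp

/-- Discounted Poisson equation `u - β K u = q`. -/
lemma resolvent_poisson (hK : K ∈ Matrix.rowStochastic ℝ S) {β : ℝ} (h0 : 0 ≤ β) (h1 : β < 1)
    (q : S → ℝ) (x : S) :
    ∑ y, resolvent K β x y * q y - β * ∑ z, K x z * ∑ y, resolvent K β z y * q y = q x := by
  have : ∀ y, resolvent K β x y * q y - β * ∑ z, K x z * (resolvent K β z y * q y) =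
      (1 : Matrix S S ℝ) x y * q y := by
    intro y
    rw [← resolvent_eq hK h0 h1, sub_mul, mul_assoc, Finset.sum_mul]
    simp_rw [mul_assoc]
  calc _ = ∑ y, (resolvent K β x y * q y - β * ∑ z, K x z * (resolvent K β z y * q y)) := by
        simp_rw [Finset.sum_sub_distrib, ← Finset.mul_sum, Finset.mul_sum]
        congr 1
        rw [Finset.sum_comm]
    _ = q x := by simp_rw [this, Matrix.one_apply]; simp

/-- Poisson equation `v - K v = h`, solvable for `h` of stationary mean zero. -/
lemma IsErgodicChain.deviation_poisson (hK : K ∈ Matrix.rowStochastic ℝ S)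
    (h : IsErgodicChain K μ) (q : S → ℝ) (hq : ∑ y, μ y * q y = 0) (x : S) :
    ∑ y, deviation K μ x y * q y - ∑ z, K x z * ∑ y, deviation K μ z y * q y = q x := by
  have : ∀ y, deviation K μ x y * q y - ∑ z, K x z * (deviation K μ z y * q y) =
      (1 : Matrix S S ℝ) x y * q y - μ y * q y := by
    intro y
    rw [← sub_mul, ← h.deviation_eq hK, sub_mul, Finset.sum_mul]
    simp_rw [mul_assoc]
  calc _ = ∑ y, (deviation K μ x y * q y - ∑ z, K x z * (deviation K μ z y * q y)) := by
        simp_rw [Finset.sum_sub_distrib, Finset.mul_sum]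
        congr 1
        rw [Finset.sum_comm]
    _ = q x := by simp_rw [this, Finset.sum_sub_distrib, hq, Matrix.one_apply]; simp

end Chain

/-! ### The smallest eigenvalue of the feature covariance -/

section FeatureCovariance

variable {S : Type*} [Fintype S] [DecidableEq S] {d : ℕ}
  {φ : S → EuclideanSpace ℝ (Fin d)} {μ : S → ℝ}

omit [Fintype S] [DecidableEq S] in
lemma featureMatrix_mulVec (φ : S → EuclideanSpace ℝ (Fin d)) (δ : EuclideanSpace ℝ (Fin d))
    (x : S) : (featureMatrix φ).mulVec (fun i => δ i) x = ⟪φ x, δ⟫ := by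
  simp [featureMatrix, Matrix.mulVec, dotProduct, PiLp.inner_apply, mul_comm]

lemma dotProduct_featureCov (φ : S → EuclideanSpace ℝ (Fin d)) (μ : S → ℝ)
    (δ : EuclideanSpace ℝ (Fin d)) :
    (fun i => δ i) ⬝ᵥ (featureCov φ μ).mulVec (fun i => δ i) = ∑ x, μ x * ⟪φ x, δ⟫ ^ 2 := by
  rw [featureCov, ← Matrix.mulVec_mulVec, ← Matrix.mulVec_mulVec, Matrix.dotProduct_mulVec,
    Matrix.vecMul_transpose, dotProduct]
  simp_rw [Matrix.mulVec_diagonal, featureMatrix_mulVec]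
  exact Finset.sum_congr rfl fun x _ => by ring

lemma featureCov_posDef (hμ : ∀ x, 0 < μ x) (hrank : (featureMatrix φ).rank = d) :
    (featureCov φ μ).PosDef := by
  have hinj : Function.Injective (featureMatrix φ).mulVec := by
    have h := LinearMap.finrank_range_add_finrank_ker (featureMatrix φ).mulVecLin
    rw [Matrix.rank] at hrank
    simp only [Module.finrank_fintype_fun_eq_card, Fintype.card_fin] at h
    have h0 : Module.finrank ℝ (LinearMap.ker (featureMatrix φ).mulVecLin) = 0 := by omega
    rw [Submodule.finrank_eq_zero] at h0
    exact LinearMap.ker_eq_bot.1 h0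
  have := (Matrix.posDef_diagonal_iff.2 hμ).conjTranspose_mul_mul_same hinj
  rwa [Matrix.conjTranspose_eq_transpose_of_trivial] at this

lemma lamMin_pos [NeZero d] (hμ : ∀ x, 0 < μ x) (hrank : (featureMatrix φ).rank = d) :
    0 < lamMin φ μ := by
  have hpd := featureCov_posDef hμ hrank
  rw [lamMin, hpd.1.spectrum_real_eq_range_eigenvalues]
  obtain ⟨i, hi⟩ := (Set.range_nonempty hpd.1.eigenvalues).csInf_mem (Set.finite_range _)
  rw [← hi]
  exact hpd.eigenvalues_pos i

/-- The Rayleigh bound for the smallest eigenvalue of the feature covariance. -/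
lemma lamMin_mul_le (hμ : ∀ x, 0 < μ x) (hrank : (featureMatrix φ).rank = d)
    (δ : EuclideanSpace ℝ (Fin d)) :
    lamMin φ μ * ‖δ‖ ^ 2 ≤ ∑ x, μ x * ⟪φ x, δ⟫ ^ 2 := by
  have hpd := featureCov_posDef hμ hrank
  have hbdd : BddBelow (spectrum ℝ (featureCov φ μ)) := by
    rw [hpd.1.spectrum_real_eq_range_eigenvalues]
    exact (Set.finite_range _).bddBelow
  have hpsd : (featureCov φ μ - algebraMap ℝ _ (lamMin φ μ)).PosSemidef := by
    rw [Matrix.posSemidef_iff_isHermitian_and_spectrum_nonneg]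
    refine ⟨hpd.1.sub ?_, fun t ht => ?_⟩
    · rw [Matrix.algebraMap_eq_diagonal]
      exact Matrix.isHermitian_diagonal _
    · have h := spectrum.add_mem_add_iff (s := lamMin φ μ) |>.2 ht
      rw [add_sub_cancel] at h
      have := csInf_le hbdd h
      change lamMin φ μ ≤ t + lamMin φ μ at this
      change 0 ≤ t
      linarith
  have h := hpsd.dotProduct_mulVec_nonneg (fun i => δ i)
  rw [Matrix.sub_mulVec, dotProduct_sub, star_trivial, dotProduct_featureCov,
    Algebra.algebraMap_eq_smul_one, Matrix.smul_mulVec, Matrix.one_mulVec, dotProduct_smul] at h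
  have e : (fun i => δ i) ⬝ᵥ (fun i => δ i) = ‖δ‖ ^ 2 := by
    rw [EuclideanSpace.real_norm_sq_eq]; simp [dotProduct, sq]
  rw [e, smul_eq_mul] at h
  linarith

end FeatureCovariance

/-! ### The mean update and its monotonicity -/

section MeanDynamics

variable {S A : Type*} [Fintype S] [Fintype A] [DecidableEq S] {d : ℕ}

/-- The expected reward in a state, under the policy. -/
def meanReward (M : MDP S A) (π : Policy S A) (x : S) : ℝ := ∑ a, π.prob x a * M.r x a

/-- The conditional expectation of the temporal difference `r_n + γ φ_{n+1}ᵀ w - φ_nᵀ w`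
given `x_n = x`. -/
noncomputable def meanTD (M : MDP S A) (π : Policy S A) (φ : S → EuclideanSpace ℝ (Fin d))
    (γ : ℝ) (w : EuclideanSpace ℝ (Fin d)) (x : S) : ℝ :=
  meanReward M π x + γ * ∑ y, transition M π x y * ⟪φ y, w⟫ - ⟪φ x, w⟫

/-- The discounted sum `∑ₖ βᵏ Kᵏ q_w` of the mean temporal differences `q_w = meanTD w`. -/
noncomputable def discountedTD (M : MDP S A) (π : Policy S A) (φ : S → EuclideanSpace ℝ (Fin d))
    (γ β : ℝ) (w : EuclideanSpace ℝ (Fin d)) (x : S) : ℝ :=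
  ∑ y, resolvent (transition M π) β x y * meanTD M π φ γ w y

/-- The component along `w - w_*` of the steady-state mean update
`𝔼_∞ [(r_n + γ φ_{n+1}ᵀ w - φ_nᵀ w) e_{-∞:n}]`. -/
noncomputable def meanDrift (M : MDP S A) (π : Policy S A) (μ : S → ℝ)
    (φ : S → EuclideanSpace ℝ (Fin d)) (γ β : ℝ) (wstar w : EuclideanSpace ℝ (Fin d)) : ℝ :=
  ∑ x, μ x * (discountedTD M π φ γ β w x * ⟪φ x, w - wstar⟫)

variable (M : MDP S A) (π : Policy S A) {μ : S → ℝ} (φ : S → EuclideanSpace ℝ (Fin d))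

omit [DecidableEq S] in
lemma sum_prob_mul_P (x y : S) : ∑ a, π.prob x a * M.P a x y = transition M π x y := by
  simp [transition, mul_comm]

lemma steadyTraceMean_eq {γ lam : ℝ} (h0 : 0 ≤ lam * γ) (h1 : lam * γ < 1) (f : S → A → S → ℝ) :
    steadyTraceMean M π μ φ γ lam f =
      ∑ x, (μ x * ∑ y, resolvent (transition M π) (lam * γ) x y *
        ∑ a, ∑ z, π.prob y a * M.P a y z * f y a z) • φ x := by
  refine HasSum.tsum_eq ?_
  have e : (fun k : ℕ => (lam * γ) ^ k • ∑ x, ∑ y, ∑ a, ∑ z,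
      (μ x * (transition M π ^ k) x y * π.prob y a * M.P a y z * f y a z) • φ x) =
      fun k => ∑ x, (μ x * ∑ y, ((lam * γ) ^ k * (transition M π ^ k) x y) *
        ∑ a, ∑ z, π.prob y a * M.P a y z * f y a z) • φ x := by
    funext k
    rw [Finset.smul_sum]
    refine Finset.sum_congr rfl fun x _ => ?_
    simp_rw [← Finset.sum_smul, smul_smul]
    congr 1
    simp_rw [Finset.mul_sum]
    refine Finset.sum_congr rfl fun y _ => Finset.sum_congr rfl fun a _ =>
      Finset.sum_congr rfl fun z _ => by ring
  rw [e]
  have hs : ∀ x, HasSum (fun k : ℕ => μ x * ∑ y, ((lam * γ) ^ k * (transition M π ^ k) x y) *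
      ∑ a, ∑ z, π.prob y a * M.P a y z * f y a z)
      (μ x * ∑ y, resolvent (transition M π) (lam * γ) x y *
        ∑ a, ∑ z, π.prob y a * M.P a y z * f y a z) := fun x =>
    (hasSum_sum fun y _ =>
      (hasSum_resolvent (transition_mem_rowStochastic M π) h0 h1 x y).mul_right _).mul_left _
  exact hasSum_sum fun x _ => (hs x).smul_const (φ x)

/-- The steady-state TD equation says that the mean update vanishes at `w_*`. -/
lemma IsTDSolution.sum_discountedTD {γ lam : ℝ} {wstar : EuclideanSpace ℝ (Fin d)}
    (h : IsTDSolution M π μ φ γ lam wstar) (h0 : 0 ≤ lam * γ) (h1 : lam * γ < 1)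
    (δ : EuclideanSpace ℝ (Fin d)) :
    ∑ x, μ x * (discountedTD M π φ γ (lam * γ) wstar x * ⟪φ x, δ⟫) = 0 := by
  have hP : ∀ y a, ∑ z, π.prob y a * M.P a y z = π.prob y a := fun y a => by
    rw [← Finset.mul_sum, M.P_sum, mul_one]
  have e1 : ∀ y, ∑ a, ∑ z, π.prob y a * M.P a y z * M.r y a = meanReward M π y := by
    intro y
    simp_rw [← Finset.sum_mul, hP]; rfl
  have e2 : ∀ y, ∑ a, ∑ z, π.prob y a * M.P a y z * (⟪φ y, wstar⟫ - γ * ⟪φ z, wstar⟫) =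
      ⟪φ y, wstar⟫ - γ * ∑ z, transition M π y z * ⟪φ z, wstar⟫ := by
    intro y
    simp_rw [mul_sub, Finset.sum_sub_distrib, ← Finset.sum_mul, hP, π.sum_one, one_mul]
    rw [Finset.sum_comm]
    simp_rw [← Finset.sum_mul, sum_prob_mul_P, Finset.mul_sum]
    congr 1
    exact Finset.sum_congr rfl fun z _ => by ring
  rw [IsTDSolution, steadyTraceMean_eq M π φ h0 h1, steadyTraceMean_eq M π φ h0 h1] at h
  simp_rw [e1, e2] at h
  have h' := congrArg (fun v => ⟪v, δ⟫) h.symm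
  simp only [sum_inner, real_inner_smul_left] at h'
  rw [← sub_eq_zero, ← Finset.sum_sub_distrib] at h'
  rw [← h']
  refine Finset.sum_congr rfl fun x _ => ?_
  rw [← sub_mul, ← mul_sub, ← Finset.sum_sub_distrib, discountedTD, ← mul_assoc]
  congr 2
  exact Finset.sum_congr rfl fun y _ => by rw [meanTD]; ring

/-- Correlations of a stationary chain are bounded by the second moment. -/
lemma abs_correlation_le {K : Matrix S S ℝ} (hK : K ∈ Matrix.rowStochastic ℝ S)
    (hμ : IsSteadyState K μ) (f : S → ℝ) :
    |∑ x, ∑ y, μ x * K x y * (f x * f y)| ≤ ∑ x, μ x * f x ^ 2 := by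
  have e : ∑ x, ∑ y, μ x * K x y * ((f x ^ 2 + f y ^ 2) / 2) = ∑ x, μ x * f x ^ 2 := by
    have h1 : ∑ x, ∑ y, μ x * K x y * f x ^ 2 = ∑ x, μ x * f x ^ 2 := by
      simp_rw [← Finset.sum_mul, ← Finset.mul_sum, Matrix.sum_row_of_mem_rowStochastic hK, mul_one]
    have h2 : ∑ x, ∑ y, μ x * K x y * f y ^ 2 = ∑ x, μ x * f x ^ 2 := by
      rw [Finset.sum_comm]
      simp_rw [← Finset.sum_mul, hμ.invariant]
    have : ∀ x y, μ x * K x y * ((f x ^ 2 + f y ^ 2) / 2) =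
        (μ x * K x y * f x ^ 2 + μ x * K x y * f y ^ 2) / 2 := fun x y => by ring
    simp_rw [this, ← Finset.sum_div, Finset.sum_add_distrib, h1, h2]; ring
  rw [← e]
  refine (Finset.abs_sum_le_sum_abs _ _).trans (Finset.sum_le_sum fun x _ =>
    (Finset.abs_sum_le_sum_abs _ _).trans (Finset.sum_le_sum fun y _ => ?_))
  have h0 : 0 ≤ μ x * K x y :=
    mul_nonneg (hμ.nonneg x) (Matrix.nonneg_of_mem_rowStochastic hK)
  rw [abs_mul, abs_of_nonneg h0]
  refine mul_le_mul_of_nonneg_left (abs_le.2 ⟨?_, ?_⟩) h0 <;>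
    nlinarith [sq_nonneg (f x + f y), sq_nonneg (f x - f y)]

/-- The operator `∑ₖ (λγ)ᵏ Kᵏ (γK - 1)` is negative definite with modulus `1 - κ` on `L²(μ)`:
the correlations `aₖ = ⟨f, Kᵏ f⟩` satisfy `|aₖ| ≤ a₀`, and the sum telescopes to
`-a₀ + γ(1 - λ) ∑ₖ (λγ)ᵏ aₖ₊₁`. -/
lemma resolvent_quadratic_le {K : Matrix S S ℝ} (hK : K ∈ Matrix.rowStochastic ℝ S)
    (hμ : IsSteadyState K μ) {γ lam : ℝ} (hγ : γ ∈ Set.Ioo (0 : ℝ) 1)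
    (hlam : lam ∈ Set.Icc (0 : ℝ) 1) (f : S → ℝ) :
    ∑ x, μ x * ((∑ y, resolvent K (lam * γ) x y * (γ * ∑ z, K y z * f z - f y)) * f x) ≤
      -(1 - kappa γ lam) * ∑ x, μ x * f x ^ 2 := by
  obtain ⟨hγ0, hγ1⟩ := hγ
  obtain ⟨hl0, hl1⟩ := hlam
  have hβ0 : 0 ≤ lam * γ := by positivity
  have hβ1 : lam * γ < 1 := by nlinarith
  set β := lam * γ with hβ
  set a : ℕ → ℝ := fun k => ∑ x, ∑ y, μ x * (K ^ k) x y * (f x * f y) with ha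
  set a₀ := ∑ x, μ x * f x ^ 2 with ha₀
  have hak : ∀ k, |a k| ≤ a₀ := fun k => abs_correlation_le (pow_mem hK k) (hμ.pow k) f
  have ha0 : a 0 = a₀ := by
    simp only [ha, ha₀, pow_zero, Matrix.one_apply]
    refine Finset.sum_congr rfl fun x _ => ?_
    simp [sq]
  have hsum : HasSum (fun k : ℕ => β ^ k * (γ * a (k + 1) - a k))
      (∑ x, μ x * ((∑ y, resolvent K β x y * (γ * ∑ z, K y z * f z - f y)) * f x)) := by
    have hpow : ∀ k, ∑ x, μ x * ((∑ y, β ^ k * (K ^ k) x y * (γ * ∑ z, K y z * f z - f y)) * f x) =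
        β ^ k * (γ * a (k + 1) - a k) := by
      intro k
      have h1 : ∀ x, ∑ y, (K ^ k) x y * (γ * ∑ z, K y z * f z) =
          γ * ∑ z, (K ^ (k + 1)) x z * f z := by
        intro x
        simp_rw [pow_succ, Matrix.mul_apply, Finset.sum_mul, Finset.mul_sum]
        rw [Finset.sum_comm]
        exact Finset.sum_congr rfl fun z _ => Finset.sum_congr rfl fun y _ => by ring
      have h2 : ∀ j, a j = ∑ x, μ x * ((∑ y, (K ^ j) x y * f y) * f x) := by
        intro j
        simp_rw [ha, Finset.sum_mul, Finset.mul_sum]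
        exact Finset.sum_congr rfl fun z _ => Finset.sum_congr rfl fun y _ => by ring
      rw [h2, h2, Finset.mul_sum, ← Finset.sum_sub_distrib, Finset.mul_sum]
      refine Finset.sum_congr rfl fun x _ => ?_
      simp_rw [mul_assoc, ← Finset.mul_sum, mul_sub, Finset.sum_sub_distrib, h1]
      ring
    have hs : ∀ x, HasSum
        (fun k : ℕ => μ x * ((∑ y, β ^ k * (K ^ k) x y * (γ * ∑ z, K y z * f z - f y)) * f x))
        (μ x * ((∑ y, resolvent K β x y * (γ * ∑ z, K y z * f z - f y)) * f x)) := fun x =>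
      ((hasSum_sum fun y _ => (hasSum_resolvent hK hβ0 hβ1 x y).mul_right _).mul_right _).mul_left _
    have := hasSum_sum fun x (_ : x ∈ Finset.univ) => hs x
    simp_rw [hpow] at this
    exact this
  have hs1 : Summable fun k : ℕ => β ^ k * a (k + 1) :=
    Summable.of_norm_bounded ((summable_geometric_of_lt_one hβ0 hβ1).mul_right a₀) fun k => by
      rw [norm_mul, Real.norm_of_nonneg (pow_nonneg hβ0 k)]
      exact mul_le_mul_of_nonneg_left (hak _) (pow_nonneg hβ0 k)
  have hs2 : HasSum (fun k : ℕ => β ^ k * a k) (a₀ + β * ∑' k : ℕ, β ^ k * a (k + 1)) := by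
    rw [← hasSum_nat_add_iff' 1]
    have e : (fun k : ℕ => β ^ (k + 1) * a (k + 1)) = fun k => β * (β ^ k * a (k + 1)) := by
      funext k; rw [pow_succ]; ring
    rw [e]
    have e' : a₀ + β * ∑' k : ℕ, β ^ k * a (k + 1) - ∑ i ∈ Finset.range 1, β ^ i * a i =
        β * ∑' k : ℕ, β ^ k * a (k + 1) := by
      rw [Finset.sum_range_one, pow_zero, ha0]; ring
    rw [e']
    exact hs1.hasSum.mul_left β
  have hle : ∑' k : ℕ, β ^ k * a (k + 1) ≤ (1 - β)⁻¹ * a₀ :=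
    hasSum_le (fun k => mul_le_mul_of_nonneg_left ((le_abs_self _).trans (hak _))
      (pow_nonneg hβ0 k)) hs1.hasSum ((hasSum_geometric_of_lt_one hβ0 hβ1).mul_right a₀)
  have e : (fun k : ℕ => β ^ k * (γ * a (k + 1) - a k)) =
      fun k => γ * (β ^ k * a (k + 1)) - β ^ k * a k := by
    funext k; ring
  rw [e] at hsum
  rw [hsum.unique ((hs1.hasSum.mul_left γ).sub hs2)]
  have hk : kappa γ lam * a₀ = γ * (1 - lam) * ((1 - β)⁻¹ * a₀) := by
    rw [kappa, ← hβ]; ring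
  have hm := mul_le_mul_of_nonneg_left hle (mul_nonneg hγ0.le (sub_nonneg.2 hl1))
  rw [← hk] at hm
  have : γ * (1 - lam) = γ - β := by rw [hβ]; ring
  rw [this] at hm
  linarith

/-- Strong monotonicity of the mean update. -/
lemma meanDrift_le (hK : IsErgodicChain (transition M π) μ) {γ lam : ℝ}
    (hrank : (featureMatrix φ).rank = d) (hγ : γ ∈ Set.Ioo (0 : ℝ) 1)
    (hlam : lam ∈ Set.Icc (0 : ℝ) 1) {wstar : EuclideanSpace ℝ (Fin d)}
    (hw : IsTDSolution M π μ φ γ lam wstar) (w : EuclideanSpace ℝ (Fin d)) :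
    meanDrift M π μ φ γ (lam * γ) wstar w ≤
      -(lamMin φ μ * (1 - kappa γ lam) * ‖w - wstar‖ ^ 2) := by
  have hβ0 : 0 ≤ lam * γ := mul_nonneg hlam.1 hγ.1.le
  have hβ1 : lam * γ < 1 := by nlinarith [hlam.1, hlam.2, hγ.1, hγ.2]
  have hκ : kappa γ lam ≤ 1 := by
    rw [kappa, div_le_one (by linarith)]
    nlinarith [hγ.2]
  have hsplit : ∀ x, meanTD M π φ γ w x = meanTD M π φ γ wstar x +
      (γ * ∑ z, transition M π x z * ⟪φ z, w - wstar⟫ - ⟪φ x, w - wstar⟫) := by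
    intro x
    simp only [meanTD, inner_sub_right, mul_sub, Finset.sum_sub_distrib]
    ring
  have e : meanDrift M π μ φ γ (lam * γ) wstar w =
      ∑ x, μ x * (discountedTD M π φ γ (lam * γ) wstar x * ⟪φ x, w - wstar⟫) +
      ∑ x, μ x * ((∑ y, resolvent (transition M π) (lam * γ) x y *
        (γ * ∑ z, transition M π y z * ⟪φ z, w - wstar⟫ - ⟪φ y, w - wstar⟫)) *
          ⟪φ x, w - wstar⟫) := by
    rw [meanDrift, ← Finset.sum_add_distrib]
    refine Finset.sum_congr rfl fun x _ => ?_
    simp_rw [discountedTD, hsplit, mul_add, Finset.sum_add_distrib]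
    ring
  rw [e, hw.sum_discountedTD M π φ hβ0 hβ1, zero_add]
  refine (resolvent_quadratic_le (transition_mem_rowStochastic M π) hK.steady hγ hlam
    (fun x => ⟪φ x, w - wstar⟫)).trans ?_
  have := mul_le_mul_of_nonneg_left (lamMin_mul_le hK.pos hrank (w - wstar)) (sub_nonneg.2 hκ)
  linarith

end MeanDynamics

/-! ### The Poisson corrector of the update noise -/

section Corrector

variable {S A : Type*} [Fintype S] [Fintype A] [DecidableEq S] {d : ℕ}

/-- The corrector: a solution `Ψ` of the Poisson equation for the Markov chain `(x_n, e_n)`,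
whose right-hand side is the component along `w - w_*` of the update noise at a frozen `w`.
Because the trace obeys a linear recursion, `Ψ` is affine in `e`; its slope is a discounted sum,
its constant term a sum of deviations from the steady state. -/
noncomputable def corrector (M : MDP S A) (π : Policy S A) (μ : S → ℝ)
    (φ : S → EuclideanSpace ℝ (Fin d)) (γ β : ℝ) (wstar : EuclideanSpace ℝ (Fin d)) (x : S)
    (e w : EuclideanSpace ℝ (Fin d)) : ℝ :=
  discountedTD M π φ γ β w x * ⟪e, w - wstar⟫ +
    ∑ y, deviation (transition M π) μ x y *
      (∑ z, transition M π y z * (discountedTD M π φ γ β w z * ⟪φ z, w - wstar⟫) -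
        meanDrift M π μ φ γ β wstar w)

variable (M : MDP S A) (π : Policy S A) {μ : S → ℝ} (φ : S → EuclideanSpace ℝ (Fin d))

lemma corrector_poisson (hK : IsErgodicChain (transition M π) μ) {γ β : ℝ} (h0 : 0 ≤ β)
    (h1 : β < 1) (wstar : EuclideanSpace ℝ (Fin d)) (x : S) (e w : EuclideanSpace ℝ (Fin d)) :
    meanTD M π φ γ w x * ⟪e, w - wstar⟫ +
        ∑ z, transition M π x z * corrector M π μ φ γ β wstar z (φ z + β • e) w =
      corrector M π μ φ γ β wstar x e w + meanDrift M π μ φ γ β wstar w := by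
  have hP := transition_mem_rowStochastic M π
  set u := discountedTD M π φ γ β w with hu
  set G := meanDrift M π μ φ γ β wstar w with hG
  set h : S → ℝ := fun y => ∑ z, transition M π y z * (u z * ⟪φ z, w - wstar⟫) - G with hh
  have hmean : ∑ y, μ y * h y = 0 := by
    simp_rw [hh, mul_sub, Finset.sum_sub_distrib, ← Finset.sum_mul, hK.steady.sum_one, one_mul,
      Finset.mul_sum, ← mul_assoc]
    rw [Finset.sum_comm]
    simp_rw [mul_assoc, ← mul_assoc (μ _), ← Finset.sum_mul, hK.steady.invariant]
    rw [hG, meanDrift, sub_eq_zero]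
  have hv := hK.deviation_poisson hP h hmean x
  have hr : u x - β * ∑ z, transition M π x z * u z = meanTD M π φ γ w x :=
    resolvent_poisson hP h0 h1 (meanTD M π φ γ w) x
  have hc : ∀ z e, corrector M π μ φ γ β wstar z e w =
      u z * ⟪e, w - wstar⟫ + ∑ y, deviation (transition M π) μ z y * h y := fun _ _ => rfl
  have e1 : ∑ z, transition M π x z * corrector M π μ φ γ β wstar z (φ z + β • e) w =
      (h x + G) + β * (∑ z, transition M π x z * u z) * ⟪e, w - wstar⟫ +
        ∑ z, transition M π x z * ∑ y, deviation (transition M π) μ z y * h y := by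
    simp_rw [hc, inner_add_left, real_inner_smul_left, hh, sub_add_cancel, Finset.mul_sum,
      Finset.sum_mul, ← Finset.sum_add_distrib]
    refine Finset.sum_congr rfl fun z _ => ?_
    simp_rw [mul_add, Finset.mul_sum]
    ring
  rw [e1, hc, ← hr]
  linear_combination -hv

lemma contDiff_corrector (γ β : ℝ) (wstar : EuclideanSpace ℝ (Fin d)) (x : S) :
    ContDiff ℝ 1 fun p : EuclideanSpace ℝ (Fin d) × EuclideanSpace ℝ (Fin d) =>
      corrector M π μ φ γ β wstar x p.1 p.2 := by
  have hin : ∀ v : EuclideanSpace ℝ (Fin d), ContDiff ℝ 1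
      fun p : EuclideanSpace ℝ (Fin d) × EuclideanSpace ℝ (Fin d) => ⟪v, p.2 - wstar⟫ :=
    fun v => contDiff_const.inner ℝ (contDiff_snd.sub contDiff_const)
  have hu : ∀ z, ContDiff ℝ 1
      fun p : EuclideanSpace ℝ (Fin d) × EuclideanSpace ℝ (Fin d) =>
        discountedTD M π φ γ β p.2 z := fun z =>
    ContDiff.sum fun y _ => contDiff_const.mul ((contDiff_const.add (contDiff_const.mul
      (ContDiff.sum fun _ _ => contDiff_const.mul (contDiff_const.inner ℝ contDiff_snd)))).sub
        (contDiff_const.inner ℝ contDiff_snd))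
  refine ((hu x).mul (contDiff_fst.inner ℝ (contDiff_snd.sub contDiff_const))).add
    (ContDiff.sum fun y _ => contDiff_const.mul (ContDiff.sub ?_ ?_))
  · exact ContDiff.sum fun z _ => contDiff_const.mul ((hu z).mul (hin _))
  · exact ContDiff.sum fun z _ => contDiff_const.mul ((hu z).mul (hin _))

/-- On bounded sets the corrector is bounded, and Lipschitz in the parameter. -/
lemma exists_corrector_bound (μ : S → ℝ) (γ β : ℝ) (wstar : EuclideanSpace ℝ (Fin d))
    (a b : ℝ) : ∃ B L : ℝ, 0 ≤ B ∧ 0 ≤ L ∧ ∀ x e w, ‖e‖ ≤ a → ‖w‖ ≤ b →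
      |corrector M π μ φ γ β wstar x e w| ≤ B ∧
      ∀ w', ‖w'‖ ≤ b → |corrector M π μ φ γ β wstar x e w' -
        corrector M π μ φ γ β wstar x e w| ≤ L * ‖w' - w‖ := by
  set s : Set (EuclideanSpace ℝ (Fin d) × EuclideanSpace ℝ (Fin d)) :=
    Metric.closedBall 0 a ×ˢ Metric.closedBall 0 b
  have hs : IsCompact s := (isCompact_closedBall _ _).prod (isCompact_closedBall _ _)
  have hcv : Convex ℝ s := (convex_closedBall _ _).prod (convex_closedBall _ _)
  have hcd := contDiff_corrector M π (μ := μ) φ γ β wstar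
  choose B hB using fun x => hs.exists_bound_of_continuousOn (hcd x).continuous.continuousOn
  choose L hL using fun x => (hcd x).contDiffOn.exists_lipschitzOnWith one_ne_zero hcv hs
  refine ⟨∑ x, |B x|, ∑ x, (L x : ℝ), Finset.sum_nonneg fun _ _ => abs_nonneg _,
    Finset.sum_nonneg fun _ _ => NNReal.coe_nonneg _, fun x e w he hw => ⟨?_, fun w' hw' => ?_⟩⟩
  · refine ((hB x (e, w) ⟨by simpa using he, by simpa using hw⟩).trans (le_abs_self _)).trans ?_
    exact Finset.single_le_sum (f := fun x => |B x|) (fun _ _ => abs_nonneg _) (Finset.mem_univ x)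
  · have := (hL x).norm_sub_le (x := (e, w')) (y := (e, w))
      ⟨by simpa using he, by simpa using hw'⟩ ⟨by simpa using he, by simpa using hw⟩
    rw [Prod.mk_sub_mk, sub_self, Prod.norm_mk, norm_zero, max_eq_right (norm_nonneg _)] at this
    refine this.trans (mul_le_mul_of_nonneg_right ?_ (norm_nonneg _))
    exact Finset.single_le_sum (f := fun x => (L x : ℝ)) (fun _ _ => NNReal.coe_nonneg _)
      (Finset.mem_univ x)

end Corrector

/-! ### Markov property of the trajectory -/

section Probability

variable {Ω : Type*} [MeasurableSpace Ω] {Pr : Measure Ω}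

lemma integrable_comp_fintype [IsFiniteMeasure Pr] {ι : Type*} [Finite ι] [MeasurableSpace ι]
    [MeasurableSingletonClass ι] {p : Ω → ι} (hp : Measurable p) (g : ι → ℝ) :
    Integrable (fun ω => g (p ω)) Pr :=
  (integrable_map_measure (measurable_of_countable g).aestronglyMeasurable hp.aemeasurable).1
    .of_finite

lemma integral_comp_fintype [IsFiniteMeasure Pr] {ι : Type*} [Fintype ι] [MeasurableSpace ι]
    [MeasurableSingletonClass ι] {p : Ω → ι} (hp : Measurable p) (g : ι → ℝ) :
    ∫ ω, g (p ω) ∂Pr = ∑ i, Pr.real (p ⁻¹' {i}) * g i := by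
  rw [← integral_map hp.aemeasurable (measurable_of_countable g).aestronglyMeasurable,
    integral_fintype .of_finite]
  refine Finset.sum_congr rfl fun i _ => ?_
  rw [map_measureReal_apply hp (measurableSet_singleton i), smul_eq_mul]

variable {S A : Type*}

/-- The part `(x_1, …, x_n, a_1, …, a_{n-1})` of a path which determines `w_n` and `e_n`. -/
def pathData (n : ℕ) (x : ℕ → S) (a : ℕ → A) :
    (Finset.Icc 1 n → S) × (Finset.Ico 1 n → A) :=
  (fun i => x i, fun i => a i)

lemma pathData_eq_iff {n : ℕ} {x x' : ℕ → S} {a a' : ℕ → A} :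
    pathData n x a = pathData n x' a' ↔
      (∀ i ∈ Finset.Icc 1 n, x i = x' i) ∧ ∀ i ∈ Finset.Ico 1 n, a i = a' i := by
  simp [pathData, funext_iff]

/-- The random history `(x_1, …, x_n, a_1, …, a_{n-1})` at time `n`, before `a_n` is drawn. -/
def history (X : ℕ → Ω → S) (Act : ℕ → Ω → A) (n : ℕ) (ω : Ω) :
    (Finset.Icc 1 n → S) × (Finset.Ico 1 n → A) :=
  pathData n (fun k => X k ω) (fun k => Act k ω)

variable [Fintype S] [Fintype A] [MeasurableSpace S] [DiscreteMeasurableSpace S]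
  [MeasurableSpace A] [DiscreteMeasurableSpace A]
  {M : MDP S A} {π : Policy S A} {μ : S → ℝ} {X : ℕ → Ω → S} {Act : ℕ → Ω → A}

omit [DiscreteMeasurableSpace S] [DiscreteMeasurableSpace A] in
lemma IsTrajectory.measurable_history (hX : IsTrajectory M π μ Pr X Act) (n : ℕ) :
    Measurable (history X Act n) :=
  (measurable_pi_lambda _ fun ⟨i, hi⟩ => hX.measurable_state i (Finset.mem_Icc.1 hi).1).prodMk
    (measurable_pi_lambda _ fun ⟨i, hi⟩ => hX.measurable_action i (Finset.mem_Ico.1 hi).1)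

/-- The law of the history, obtained from the law of `(x_1, a_1, …, x_n, a_n)` by summing
over `a_n`. -/
lemma IsTrajectory.law_history [IsFiniteMeasure Pr] (hX : IsTrajectory M π μ Pr X Act) {n : ℕ}
    (hn : 1 ≤ n) (s : ℕ → S) (a : ℕ → A) :
    Pr.real (history X Act n ⁻¹' {pathData n s a}) =
      μ (s 1) * (∏ i ∈ Finset.Ico 1 n, π.prob (s i) (a i)) *
        ∏ i ∈ Finset.Ico 1 n, M.P (a i) (s i) (s (i + 1)) := by
  classical
  have hset : history X Act n ⁻¹' {pathData n s a} =
      ⋃ b ∈ (Finset.univ : Finset A), {ω | ∀ i ∈ Finset.Icc 1 n, X i ω = s i ∧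
        Act i ω = Function.update a n b i} := by
    ext ω
    simp only [Set.mem_preimage, Set.mem_singleton_iff, history, pathData_eq_iff,
      Set.mem_iUnion, Finset.mem_univ, exists_prop, true_and, Set.mem_ofPred_eq, Finset.mem_Icc, Finset.mem_Ico]
    constructor
    · rintro ⟨h1, h2⟩
      refine ⟨Act n ω, fun i hi => ⟨h1 i hi, ?_⟩⟩
      rcases eq_or_ne i n with rfl | hne
      · simp
      · rw [Function.update_of_ne hne, h2 i ⟨hi.1, lt_of_le_of_ne hi.2 hne⟩]
    · rintro ⟨b, h⟩
      refine ⟨fun i hi => (h i hi).1, fun i hi => ?_⟩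
      rw [(h i ⟨hi.1, hi.2.le⟩).2, Function.update_of_ne hi.2.ne]
  have hdisj : Set.PairwiseDisjoint ↑(Finset.univ : Finset A) fun b =>
      {ω | ∀ i ∈ Finset.Icc 1 n, X i ω = s i ∧ Act i ω = Function.update a n b i} := by
    intro b _ b' _ hb
    refine Set.disjoint_left.2 fun ω h h' => hb ?_
    have h1 := (h n (Finset.mem_Icc.2 ⟨hn, le_rfl⟩)).2
    have h2 := (h' n (Finset.mem_Icc.2 ⟨hn, le_rfl⟩)).2
    simpa using h1.symm.trans h2
  have hmeas : ∀ b ∈ (Finset.univ : Finset A), MeasurableSet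
      {ω | ∀ i ∈ Finset.Icc 1 n, X i ω = s i ∧ Act i ω = Function.update a n b i} := by
    intro b _
    have : {ω | ∀ i ∈ Finset.Icc 1 n, X i ω = s i ∧ Act i ω = Function.update a n b i} =
        ⋂ i ∈ Finset.Icc 1 n, (X i ⁻¹' {s i} ∩ Act i ⁻¹' {Function.update a n b i}) := by
      ext ω; simp
    rw [this]
    refine Finset.measurableSet_biInter _ fun i hi => ?_
    have hi1 := (Finset.mem_Icc.1 hi).1
    exact (hX.measurable_state i hi1 (measurableSet_singleton _)).inter
      (hX.measurable_action i hi1 (measurableSet_singleton _))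
  rw [hset, measureReal_biUnion_finset hdisj hmeas]
  have hlaw : ∀ b, Pr.real {ω | ∀ i ∈ Finset.Icc 1 n, X i ω = s i ∧
      Act i ω = Function.update a n b i} = (μ (s 1) * (∏ i ∈ Finset.Ico 1 n, π.prob (s i) (a i)) *
        ∏ i ∈ Finset.Ico 1 n, M.P (a i) (s i) (s (i + 1))) * π.prob (s n) b := by
    intro b
    have h1 : ∏ i ∈ Finset.Ico 1 n, π.prob (s i) (Function.update a n b i) =
        ∏ i ∈ Finset.Ico 1 n, π.prob (s i) (a i) := Finset.prod_congr rfl fun i hi => by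
      rw [Function.update_of_ne (Finset.mem_Ico.1 hi).2.ne]
    have h2 : ∏ i ∈ Finset.Ico 1 n, M.P (Function.update a n b i) (s i) (s (i + 1)) =
        ∏ i ∈ Finset.Ico 1 n, M.P (a i) (s i) (s (i + 1)) := Finset.prod_congr rfl fun i hi => by
      rw [Function.update_of_ne (Finset.mem_Ico.1 hi).2.ne]
    rw [hX.law n hn, ← Finset.Ico_add_one_right_eq_Icc,
      Finset.prod_Ico_succ_top hn, h1, h2,
      Function.update_self]
    ring
  simp_rw [hlaw, ← Finset.mul_sum, π.sum_one, mul_one]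

/-- The Markov property: conditionally on the history, `(a_n, x_{n+1})` is distributed
according to `π(a | x_n) P(x' | a, x_n)`. -/
lemma IsTrajectory.integral_step [IsProbabilityMeasure Pr] (hX : IsTrajectory M π μ Pr X Act)
    {n : ℕ} (hn : 1 ≤ n) {T : Type*} {Y : Ω → T}
    (hY : Function.FactorsThrough Y (history X Act n)) (H : T → A → S → ℝ) :
    ∫ ω, H (Y ω) (Act n ω) (X (n + 1) ω) ∂Pr =
      ∫ ω, ∑ b, ∑ z, π.prob (X n ω) b * M.P b (X n ω) z * H (Y ω) b z ∂Pr := by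
  classical
  obtain ⟨ω₁⟩ : Nonempty Ω := nonempty_of_isProbabilityMeasure Pr
  obtain ⟨y, hy⟩ : ∃ y, ∀ ω, y (history X Act n ω) = Y ω :=
    ⟨Function.extend (history X Act n) Y fun _ => Y ω₁, fun ω => hY.extend_apply _ ω⟩
  have hn' : n ∈ Finset.Icc 1 n := Finset.mem_Icc.2 ⟨hn, le_rfl⟩
  have hm := hX.measurable_history n
  have hm' : Measurable fun ω => (history X Act n ω, Act n ω, X (n + 1) ω) :=
    hm.prodMk ((hX.measurable_action n hn).prodMk (hX.measurable_state (n + 1) (by omega)))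
  have e1 := integral_comp_fintype (Pr := Pr) hm' fun p => H (y p.1) p.2.1 p.2.2
  have e2 := integral_comp_fintype (Pr := Pr) hm fun h => ∑ b, ∑ z,
    π.prob (h.1 ⟨n, hn'⟩) b * M.P b (h.1 ⟨n, hn'⟩) z * H (y h) b z
  simp only [hy] at e1 e2
  refine e1.trans (Eq.trans ?_ e2.symm)
  rw [Fintype.sum_prod_type]
  refine Finset.sum_congr rfl fun h _ => ?_
  rw [Fintype.sum_prod_type, Finset.mul_sum]
  refine Finset.sum_congr rfl fun b _ => ?_
  rw [Finset.mul_sum]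
  refine Finset.sum_congr rfl fun z _ => ?_
  rw [← mul_assoc, ← mul_assoc]
  refine congrArg (· * H (y h) b z) ?_
  by_cases hne : ∃ ω₀, history X Act n ω₀ = h
  · obtain ⟨ω₀, rfl⟩ := hne
    have h1 := hX.law_history hn (fun i => X i ω₀) (fun i => Act i ω₀)
    have h2 := hX.law_history (n := n + 1) (by omega)
      (Function.update (fun i => X i ω₀) (n + 1) z) (Function.update (fun i => Act i ω₀) n b)
    have hset : (fun ω => (history X Act n ω, Act n ω, X (n + 1) ω)) ⁻¹'
        {(history X Act n ω₀, b, z)} = history X Act (n + 1) ⁻¹'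
          {pathData (n + 1) (Function.update (fun i => X i ω₀) (n + 1) z)
            (Function.update (fun i => Act i ω₀) n b)} := by
      ext ω
      simp only [Set.mem_preimage, Set.mem_singleton_iff, history, pathData_eq_iff,
        Prod.mk.injEq, Finset.mem_Icc, Finset.mem_Ico]
      constructor
      · rintro ⟨⟨h1, h2⟩, h3, h4⟩
        refine ⟨fun i hi => ?_, fun i hi => ?_⟩
        · rcases eq_or_ne i (n + 1) with rfl | hne
          · simpa using h4
          · rw [Function.update_of_ne hne, h1 i ⟨hi.1, by omega⟩]
        · rcases eq_or_ne i n with rfl | hne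
          · simpa using h3
          · rw [Function.update_of_ne hne, h2 i ⟨hi.1, by omega⟩]
      · rintro ⟨h1, h2⟩
        refine ⟨⟨fun i hi => ?_, fun i hi => ?_⟩, ?_, ?_⟩
        · rw [h1 i ⟨hi.1, by omega⟩, Function.update_of_ne (by omega)]
        · rw [h2 i ⟨hi.1, by omega⟩, Function.update_of_ne (by omega)]
        · simpa using h2 n ⟨hn, by omega⟩
        · simpa using h1 (n + 1) ⟨by omega, le_rfl⟩
    rw [hset, h2]
    change _ = Pr.real (history X Act n ⁻¹' {pathData n (fun i => X i ω₀) (fun i => Act i ω₀)}) *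
      π.prob (X n ω₀) b * M.P b (X n ω₀) z
    rw [h1, Finset.prod_Ico_succ_top hn, Finset.prod_Ico_succ_top hn,
      Function.update_of_ne (show (1 : ℕ) ≠ n + 1 by omega),
      Function.update_of_ne (show n ≠ n + 1 by omega), Function.update_self, Function.update_self]
    have p1 : ∏ i ∈ Finset.Ico 1 n, π.prob (Function.update (fun i => X i ω₀) (n + 1) z i)
        (Function.update (fun i => Act i ω₀) n b i) =
        ∏ i ∈ Finset.Ico 1 n, π.prob (X i ω₀) (Act i ω₀) := Finset.prod_congr rfl fun i hi => by
      have := Finset.mem_Ico.1 hi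
      rw [Function.update_of_ne (by omega), Function.update_of_ne (by omega)]
    have p2 : ∏ i ∈ Finset.Ico 1 n, M.P (Function.update (fun i => Act i ω₀) n b i)
        (Function.update (fun i => X i ω₀) (n + 1) z i)
        (Function.update (fun i => X i ω₀) (n + 1) z (i + 1)) =
        ∏ i ∈ Finset.Ico 1 n, M.P (Act i ω₀) (X i ω₀) (X (i + 1) ω₀) :=
      Finset.prod_congr rfl fun i hi => by
        have := Finset.mem_Ico.1 hi
        rw [Function.update_of_ne (by omega), Function.update_of_ne (by omega),
          Function.update_of_ne (by omega)]
    rw [p1, p2]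
    ring
  · have h1 : (fun ω => (history X Act n ω, Act n ω, X (n + 1) ω)) ⁻¹' {(h, b, z)} = ∅ :=
      Set.eq_empty_of_forall_notMem fun ω hω => hne ⟨ω, congrArg Prod.fst hω⟩
    have h2 : history X Act n ⁻¹' {h} = ∅ :=
      Set.eq_empty_of_forall_notMem fun ω hω => hne ⟨ω, hω⟩
    rw [h1, h2]; simp

/-- A function of the history takes finitely many values, so it is integrable. -/
lemma IsTrajectory.integrable [IsProbabilityMeasure Pr] (hX : IsTrajectory M π μ Pr X Act)
    {n : ℕ} {f : Ω → ℝ} (hf : Function.FactorsThrough f (history X Act n)) :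
    Integrable f Pr := by
  have := integrable_comp_fintype (Pr := Pr) (hX.measurable_history n)
    (Function.extend (history X Act n) f fun _ => 0)
  simpa only [hf.extend_apply] using this

end Probability

/-! ### Step sizes -/

section StepSize

lemma stepSize_pos {α₁ l κ : ℝ} (hα₁ : 0 < α₁) (hc : 0 ≤ l * (1 - κ)) {n : ℕ} (hn : 1 ≤ n) :
    0 < stepSize α₁ l κ n := by
  have h1 : (1 : ℝ) ≤ n := by exact_mod_cast hn
  have := mul_nonneg (mul_nonneg hα₁.le hc) (sub_nonneg.2 h1)
  rw [stepSize]
  refine div_pos hα₁ ?_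
  nlinarith

/-- The step sizes satisfy `1 / α_{n+1} = 1 / α_n + c` with `c = λ_min (1 - κ)`. -/
lemma stepSize_sub {α₁ l κ : ℝ} (hα₁ : 0 < α₁) (hc : 0 ≤ l * (1 - κ)) {n : ℕ} (hn : 1 ≤ n) :
    stepSize α₁ l κ n - stepSize α₁ l κ (n + 1) =
      l * (1 - κ) * (stepSize α₁ l κ n * stepSize α₁ l κ (n + 1)) := by
  have h1 : (1 : ℝ) ≤ n := by exact_mod_cast hn
  have h2 := mul_nonneg (mul_nonneg hα₁.le hc) (sub_nonneg.2 h1)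
  have h3 := mul_nonneg hα₁.le hc
  have e1 : α₁ * l * (1 - κ) * ((n : ℝ) - 1) + 1 ≠ 0 := by
    apply ne_of_gt; nlinarith
  have e2 : α₁ * l * (1 - κ) * (((n + 1 : ℕ) : ℝ) - 1) + 1 ≠ 0 := by
    push_cast; apply ne_of_gt; nlinarith
  rw [stepSize, stepSize, div_sub_div _ _ e1 e2, div_mul_div_comm, ← mul_div_assoc]
  congr 1
  push_cast; ring

lemma mul_stepSize_le {α₁ l κ : ℝ} (hα₁ : 0 < α₁) (hc : 0 ≤ l * (1 - κ)) {n : ℕ} (hn : 1 ≤ n) :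
    l * (1 - κ) * n * stepSize α₁ l κ (n + 1) ≤ 1 := by
  have h1 : (1 : ℝ) ≤ n := by exact_mod_cast hn
  have h2 : 0 ≤ α₁ * (l * (1 - κ)) * n := by positivity
  rw [stepSize, ← mul_div_assoc, div_le_one (by push_cast; nlinarith)]
  push_cast; nlinarith

/-- A recursion with contraction rate `2 c α_n` and noise `C α_n²` is of order `α_n`, because
`α_{n+1} ≥ (1 - c α_n) α_n`. -/
lemma exists_le_mul_stepSize {α₁ l κ : ℝ} (hα₁ : 0 < α₁) (hc : 0 < l * (1 - κ)) {C : ℝ}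
    (hC : 0 ≤ C) {V : ℕ → ℝ}
    (hV : ∀ n, 2 ≤ n → V (n + 1) ≤ (1 - 2 * (l * (1 - κ)) * stepSize α₁ l κ n) * V n +
      C * stepSize α₁ l κ n ^ 2) :
    ∃ D, 0 ≤ D ∧ ∀ n, 3 ≤ n → V n ≤ D * stepSize α₁ l κ n := by
  have hpos : ∀ n, 1 ≤ n → 0 < stepSize α₁ l κ n := fun n => stepSize_pos hα₁ hc.le
  set c := l * (1 - κ) with hcdef
  refine ⟨max (V 3 / stepSize α₁ l κ 3) (C / c), le_max_of_le_right (by positivity), fun n hn => ?_⟩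
  set D := max (V 3 / stepSize α₁ l κ 3) (C / c) with hD
  have hDC : C ≤ c * D := by
    have : C / c ≤ D := le_max_right _ _
    rw [div_le_iff₀ hc] at this; linarith
  induction n, hn using Nat.le_induction with
  | base =>
    have : V 3 / stepSize α₁ l κ 3 ≤ D := le_max_left _ _
    rwa [div_le_iff₀ (hpos 3 (by norm_num))] at this
  | succ n hn ih =>
    obtain ⟨j, rfl⟩ := Nat.exists_eq_add_of_le' (show 1 ≤ n by omega)
    have h1 := hpos (j + 1) (by omega)
    have h2 := hpos (j + 1 + 1) (by omega)
    have h3 := stepSize_sub (n := j + 1) hα₁ hc.le (by omega)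
    have h4 := mul_stepSize_le (n := j) hα₁ hc.le (by omega)
    rw [← hcdef] at h3 h4
    set a := stepSize α₁ l κ (j + 1)
    set b := stepSize α₁ l κ (j + 1 + 1)
    have hj : (2 : ℝ) ≤ j := by exact_mod_cast (show 2 ≤ j by omega)
    have hca : 0 ≤ 1 - 2 * c * a := by nlinarith [mul_pos hc h1]
    have hba : b ≤ a := by nlinarith [mul_pos hc (mul_pos h1 h2)]
    have hb : a - c * a ^ 2 ≤ b := by nlinarith [mul_le_mul_of_nonneg_left hba (mul_pos hc h1).le]
    have hD0 : 0 ≤ D := by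
      by_contra hneg
      push Not at hneg
      nlinarith
    calc V (j + 1 + 1) ≤ (1 - 2 * c * a) * V (j + 1) + C * a ^ 2 := hV _ (by omega)
      _ ≤ (1 - 2 * c * a) * (D * a) + c * D * a ^ 2 := by gcongr
      _ = D * (a - c * a ^ 2) := by ring
      _ ≤ D * b := by gcongr

end StepSize

/-! ### Deterministic estimates along a path -/

section Pathwise

variable {S A : Type*} {d : ℕ}

lemma norm_projBall_le {R : ℝ} (hR : 0 ≤ R) (w : EuclideanSpace ℝ (Fin d)) :
    ‖projBall R w‖ ≤ R := by
  rw [projBall]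
  split_ifs with h
  · have : 0 < ‖w‖ := hR.trans_lt h
    rw [norm_smul, Real.norm_of_nonneg (by positivity), div_mul_cancel₀ _ this.ne']
  · exact not_lt.1 h

lemma norm_projBall_sub_le {R : ℝ} {p : EuclideanSpace ℝ (Fin d)} (hp : ‖p‖ ≤ R)
    (w : EuclideanSpace ℝ (Fin d)) : ‖projBall R w - p‖ ≤ ‖w - p‖ := by
  rw [projBall]
  split_ifs with h
  · have hR : 0 ≤ R := (norm_nonneg p).trans hp
    have hw : 0 < ‖w‖ := hR.trans_lt h
    obtain ⟨t, ht⟩ : ∃ t, t = R / ‖w‖ := ⟨_, rfl⟩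
    have ht0 : 0 ≤ t := by rw [ht]; positivity
    have ht1 : t < 1 := by rw [ht, div_lt_one hw]; exact h
    have htR : t * ‖w‖ = R := by rw [ht, div_mul_cancel₀ _ hw.ne']
    rw [← ht]
    refine (sq_le_sq₀ (norm_nonneg _) (norm_nonneg _)).1 ?_
    rw [norm_sub_sq_real, norm_sub_sq_real, norm_smul, Real.norm_of_nonneg ht0,
      real_inner_smul_left]
    have hin : ⟪w, p⟫ ≤ ‖w‖ * R := (real_inner_le_norm w p).trans (by gcongr)
    have h1 : 0 ≤ (1 - t) * (‖w‖ * R - ⟪w, p⟫) :=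
      mul_nonneg (sub_nonneg.2 ht1.le) (sub_nonneg.2 hin)
    have h2 : 0 ≤ (1 - t) ^ 2 * ‖w‖ ^ 2 := by positivity
    rw [← htR] at h1
    nlinarith
  · exact le_rfl

lemma norm_trace_le {φ : S → EuclideanSpace ℝ (Fin d)} (hφ : ∀ x, ‖φ x‖ ≤ 1) {γ lam : ℝ}
    (h0 : 0 ≤ lam * γ) (h1 : lam * γ < 1) (x : ℕ → S) (n : ℕ) :
    ‖trace φ γ lam x n‖ ≤ (1 - lam * γ)⁻¹ := by
  have hp : 0 < 1 - lam * γ := sub_pos.2 h1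
  induction n with
  | zero => simp [trace, hp.le]
  | succ n ih =>
    rw [trace]
    refine (norm_add_le _ _).trans ?_
    rw [norm_smul, Real.norm_of_nonneg h0]
    calc _ ≤ 1 + lam * γ * (1 - lam * γ)⁻¹ :=
          add_le_add (hφ _) (mul_le_mul_of_nonneg_left ih h0)
      _ = (1 - lam * γ)⁻¹ := by field_simp; ring

lemma trace_congr {φ : S → EuclideanSpace ℝ (Fin d)} {γ lam : ℝ} {x x' : ℕ → S} {n : ℕ}
    (h : ∀ i ∈ Finset.Icc 1 n, x i = x' i) : trace φ γ lam x n = trace φ γ lam x' n := by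
  induction n with
  | zero => rfl
  | succ n ih =>
    rw [trace, trace, h (n + 1) (by simp), ih fun i hi => h i ?_]
    simp only [Finset.mem_Icc] at hi ⊢
    omega

/-- The temporal difference `r_n + γ φ_{n+1}ᵀ w - φ_nᵀ w` of a transition. -/
noncomputable def tdError (r : S → A → ℝ) (φ : S → EuclideanSpace ℝ (Fin d)) (γ : ℝ)
    (w : EuclideanSpace ℝ (Fin d)) (x : S) (a : A) (z : S) : ℝ :=
  r x a + γ * ⟪φ z, w⟫ - ⟪φ x, w⟫

lemma projImplicitTD_succ (r : S → A → ℝ) (φ : S → EuclideanSpace ℝ (Fin d))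
    (γ lam R : ℝ) (α : ℕ → ℝ) (w₁ : EuclideanSpace ℝ (Fin d)) (x : ℕ → S) (a : ℕ → A) {n : ℕ}
    (hn : 1 ≤ n) :
    projImplicitTD r φ γ lam R α w₁ x a (n + 1) =
      projBall R (projImplicitTD r φ γ lam R α w₁ x a n +
        (α n / (1 + α n * ‖trace φ γ lam x n‖ ^ 2) *
          tdError r φ γ (projImplicitTD r φ γ lam R α w₁ x a n) (x n) (a n) (x (n + 1))) •
            trace φ γ lam x n) := by
  obtain ⟨j, rfl⟩ := Nat.exists_eq_add_of_le' hn
  rfl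

lemma projImplicitTD_congr (r : S → A → ℝ) (φ : S → EuclideanSpace ℝ (Fin d))
    (γ lam R : ℝ) (α : ℕ → ℝ) (w₁ : EuclideanSpace ℝ (Fin d)) {x x' : ℕ → S} {a a' : ℕ → A}
    {n : ℕ} (h : pathData n x a = pathData n x' a') :
    projImplicitTD r φ γ lam R α w₁ x a n = projImplicitTD r φ γ lam R α w₁ x' a' n := by
  rw [pathData_eq_iff] at h
  simp only [Finset.mem_Icc, Finset.mem_Ico] at h
  obtain ⟨hx, ha⟩ := h
  rcases Nat.eq_zero_or_pos n with rfl | hn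
  · rfl
  induction n, hn using Nat.le_induction with
  | base => rfl
  | succ n hn ih =>
    have hn : 1 ≤ n := hn
    rw [projImplicitTD_succ r φ γ lam R α w₁ x a hn,
      projImplicitTD_succ r φ γ lam R α w₁ x' a' hn,
      ih (fun i hi => hx i ⟨hi.1, by omega⟩) (fun i hi => ha i ⟨hi.1, by omega⟩),
      hx n ⟨hn, by omega⟩, hx (n + 1) ⟨by omega, le_rfl⟩, ha n ⟨hn, by omega⟩,
      trace_congr fun i hi => hx i ?_]
    have := Finset.mem_Icc.1 hi
    omega

lemma norm_projImplicitTD_le (r : S → A → ℝ) (φ : S → EuclideanSpace ℝ (Fin d))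
    (γ lam : ℝ) {R : ℝ} (hR : 0 ≤ R) (α : ℕ → ℝ) (w₁ : EuclideanSpace ℝ (Fin d)) (x : ℕ → S)
    (a : ℕ → A) {n : ℕ} (hn : 2 ≤ n) : ‖projImplicitTD r φ γ lam R α w₁ x a n‖ ≤ R := by
  obtain ⟨j, rfl⟩ := Nat.exists_eq_add_of_le' hn
  exact norm_projBall_le hR _

lemma exists_abs_tdError_le [Finite S] [Finite A] (r : S → A → ℝ)
    {φ : S → EuclideanSpace ℝ (Fin d)} (hφ : ∀ x, ‖φ x‖ ≤ 1) {γ : ℝ} (hγ : γ ∈ Set.Ioo (0 : ℝ) 1)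
    (R : ℝ) :
    ∃ B, 0 ≤ B ∧ ∀ w x a z, ‖w‖ ≤ R → |tdError r φ γ w x a z| ≤ B := by
  obtain ⟨b, hb⟩ := (Set.finite_range fun p : S × A => |r p.1 p.2|).bddAbove
  have hin : ∀ (w : EuclideanSpace ℝ (Fin d)) x, ‖w‖ ≤ R → |⟪φ x, w⟫| ≤ R := fun w x hw =>
    (abs_real_inner_le_norm _ _).trans
      ((mul_le_of_le_one_left (norm_nonneg w) (hφ x)).trans hw)
  refine ⟨max 0 (b + R + R), le_max_left _ _, fun w x a z hw => le_max_of_le_right ?_⟩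
  have h1 : |r x a| ≤ b := hb ⟨(x, a), rfl⟩
  have h2 : |γ * ⟪φ z, w⟫| ≤ R := by
    rw [abs_mul, abs_of_pos hγ.1]
    exact (mul_le_of_le_one_left (abs_nonneg _) hγ.2.le).trans (hin w z hw)
  exact (abs_sub _ _).trans (add_le_add ((abs_add_le _ _).trans (add_le_add h1 h2)) (hin w x hw))

/-- One implicit step: up to `O(α²)` it is the explicit step, since the effective step size
`α / (1 + α ‖e‖²)` differs from `α` by at most `α² ‖e‖²`. -/
lemma norm_implicit_step_sub_sq_le {E : Type*} [NormedAddCommGroup E] [InnerProductSpace ℝ E]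
    {α s sB eB D : ℝ} {δ e : E} (hα : 0 ≤ α) (hs : |s| ≤ sB) (he : ‖e‖ ≤ eB) (hδ : ‖δ‖ ≤ D) :
    ‖δ + (α / (1 + α * ‖e‖ ^ 2) * s) • e‖ ^ 2 ≤
      ‖δ‖ ^ 2 + 2 * α * (s * ⟪e, δ⟫) + (sB ^ 2 * eB ^ 2 + 2 * eB ^ 3 * sB * D) * α ^ 2 := by
  obtain ⟨t, ht⟩ : ∃ t, t = α / (1 + α * ‖e‖ ^ 2) := ⟨_, rfl⟩
  have hpos : 0 < 1 + α * ‖e‖ ^ 2 := by positivity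
  have ht0 : 0 ≤ t := by rw [ht]; positivity
  have ht1 : t ≤ α := by
    rw [ht, div_le_iff₀ hpos]
    nlinarith [mul_nonneg hα (mul_nonneg hα (sq_nonneg ‖e‖))]
  have hte : α - t = t * (α * ‖e‖ ^ 2) := by
    have : t * (1 + α * ‖e‖ ^ 2) = α := by rw [ht, div_mul_cancel₀ _ hpos.ne']
    linarith
  have hsB : 0 ≤ sB := (abs_nonneg s).trans hs
  have heB : 0 ≤ eB := (norm_nonneg e).trans he
  have hD : 0 ≤ D := (norm_nonneg δ).trans hδ
  rw [← ht, norm_add_sq_real, real_inner_smul_right, norm_smul, Real.norm_eq_abs, real_inner_comm,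
    abs_mul, abs_of_nonneg ht0]
  have h1 : (t * |s| * ‖e‖) ^ 2 ≤ (α * sB * eB) ^ 2 := by gcongr
  have h2 : (t - α) * (s * ⟪e, δ⟫) ≤ α * (α * eB ^ 2) * (sB * (eB * D)) := by
    calc (t - α) * (s * ⟪e, δ⟫) ≤ |(t - α) * (s * ⟪e, δ⟫)| := le_abs_self _
      _ = t * (α * ‖e‖ ^ 2) * (|s| * |⟪e, δ⟫|) := by
          rw [abs_mul, abs_sub_comm, hte, abs_mul s, abs_of_nonneg (by positivity)]
      _ ≤ α * (α * eB ^ 2) * (sB * (eB * D)) := by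
          gcongr
          exact (abs_real_inner_le_norm e δ).trans (by gcongr)
  nlinarith

lemma norm_implicit_step_le {E : Type*} [NormedAddCommGroup E] [InnerProductSpace ℝ E]
    {α s sB eB : ℝ} {e : E} (hα : 0 ≤ α) (hs : |s| ≤ sB) (he : ‖e‖ ≤ eB) :
    ‖(α / (1 + α * ‖e‖ ^ 2) * s) • e‖ ≤ α * (sB * eB) := by
  have ht1 : α / (1 + α * ‖e‖ ^ 2) ≤ α := div_le_self hα (le_add_of_nonneg_right (by positivity))
  have hsB : 0 ≤ sB := (abs_nonneg s).trans hs
  rw [norm_smul, norm_mul, Real.norm_eq_abs, Real.norm_eq_abs, abs_of_nonneg (by positivity),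
    ← mul_assoc]
  gcongr

end Pathwise

/-! ### Conditional means of the temporal difference -/

section MeanTD

variable {S A : Type*} [Fintype S] [Fintype A] {d : ℕ} (M : MDP S A) (π : Policy S A)
  (φ : S → EuclideanSpace ℝ (Fin d))

lemma sum_tdError (γ : ℝ) (w : EuclideanSpace ℝ (Fin d)) (x : S) :
    ∑ b, ∑ z, π.prob x b * M.P b x z * tdError M.r φ γ w x b z = meanTD M π φ γ w x := by
  have hP : ∀ b, ∑ z, π.prob x b * M.P b x z = π.prob x b := fun b => by
    rw [← Finset.mul_sum, M.P_sum, mul_one]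
  simp_rw [tdError, mul_sub, mul_add, Finset.sum_sub_distrib, Finset.sum_add_distrib,
    ← Finset.sum_mul, hP, π.sum_one, one_mul, meanTD, meanReward]
  rw [Finset.sum_comm (f := fun b z => π.prob x b * M.P b x z * (γ * ⟪φ z, w⟫))]
  simp_rw [← Finset.sum_mul, sum_prob_mul_P, Finset.mul_sum]
  congr 2
  exact Finset.sum_congr rfl fun z _ => by ring

lemma sum_prob_mul_P_mul (x : S) (f : S → ℝ) :
    ∑ b, ∑ z, π.prob x b * M.P b x z * f z = ∑ z, transition M π x z * f z := by
  rw [Finset.sum_comm]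
  simp_rw [← Finset.sum_mul, sum_prob_mul_P]

end MeanTD

/-! ### The Lyapunov inequality along a path -/

section Lyapunov

variable {S A : Type*} [Fintype S] [DecidableEq S] [Fintype A] {d : ℕ}

/-- Pathwise one-step inequality for the corrected squared error `‖w_n - w_*‖² + 2 α_n Ψ_n`.
Replacing `α_{n+1} Ψ(x_{n+1}, e_{n+1}, w_{n+1})` by `α_n Ψ(x_{n+1}, e_{n+1}, w_n)` costs `O(α_n²)`,
since `α_n - α_{n+1}` is of order `α_n²` and `w_{n+1} - w_n` of order `α_n`. The index `n = 1` is
left out because the initial guess may lie outside the ball. -/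
lemma exists_lyapunov_step (M : MDP S A) (π : Policy S A) (μ : S → ℝ)
    {φ : S → EuclideanSpace ℝ (Fin d)} (hφ : ∀ x, ‖φ x‖ ≤ 1) {γ lam : ℝ}
    (hγ : γ ∈ Set.Ioo (0 : ℝ) 1) (h0 : 0 ≤ lam * γ) (h1 : lam * γ < 1)
    {wstar : EuclideanSpace ℝ (Fin d)} {R : ℝ} (hR : ‖wstar‖ ≤ R)
    {α₁ l κ : ℝ} (hα₁ : 0 < α₁) (hc : 0 ≤ l * (1 - κ)) (w₁ : EuclideanSpace ℝ (Fin d)) :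
    ∃ B C : ℝ, 0 ≤ B ∧ 0 ≤ C ∧ ∀ (x : ℕ → S) (a : ℕ → A) (w e : ℕ → EuclideanSpace ℝ (Fin d)),
      w = projImplicitTD M.r φ γ lam R (stepSize α₁ l κ) w₁ x a → e = trace φ γ lam x →
      ∀ n, 2 ≤ n →
        |corrector M π μ φ γ (lam * γ) wstar (x n) (e n) (w n)| ≤ B ∧
        ‖w (n + 1) - wstar‖ ^ 2 + 2 * stepSize α₁ l κ (n + 1) *
            corrector M π μ φ γ (lam * γ) wstar (x (n + 1)) (e (n + 1)) (w (n + 1)) ≤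
          ‖w n - wstar‖ ^ 2 + 2 * stepSize α₁ l κ n *
            (tdError M.r φ γ (w n) (x n) (a n) (x (n + 1)) * ⟪e n, w n - wstar⟫ +
              corrector M π μ φ γ (lam * γ) wstar (x (n + 1)) (e (n + 1)) (w n)) +
            C * stepSize α₁ l κ n ^ 2 := by
  have hR0 : 0 ≤ R := (norm_nonneg _).trans hR
  set eB := (1 - lam * γ)⁻¹
  have heB0 : 0 ≤ eB := inv_nonneg.2 (sub_nonneg.2 h1.le)
  obtain ⟨B, L, hB0, hL0, hBL⟩ := exists_corrector_bound M π φ μ γ (lam * γ) wstar eB R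
  obtain ⟨sB, hsB0, hsB⟩ := exists_abs_tdError_le M.r hφ hγ R
  set C₁ := sB ^ 2 * eB ^ 2 + 2 * eB ^ 3 * sB * (2 * R) with hC₁
  have hC₁0 : 0 ≤ C₁ := by positivity
  refine ⟨B, C₁ + 2 * (l * (1 - κ) * B) + 2 * (L * (sB * eB)), hB0, by positivity,
    fun x a w e hw he n hn => ?_⟩
  have hwb : ∀ j, 2 ≤ j → ‖w j‖ ≤ R := fun j hj => by
    rw [hw]; exact norm_projImplicitTD_le _ _ _ _ hR0 _ _ _ _ hj
  have heb : ∀ j, ‖e j‖ ≤ eB := fun j => by rw [he]; exact norm_trace_le hφ h0 h1 x j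
  refine ⟨(hBL (x n) (e n) (w n) (heb n) (hwb n hn)).1, ?_⟩
  have hα := stepSize_pos (n := n) hα₁ hc (by omega)
  have hα' := stepSize_pos (n := n + 1) hα₁ hc (by omega)
  have hdiff := stepSize_sub (n := n) hα₁ hc (by omega)
  set α := stepSize α₁ l κ n with hαdef
  set α' := stepSize α₁ l κ (n + 1)
  set s := tdError M.r φ γ (w n) (x n) (a n) (x (n + 1)) with hs
  have hsb : |s| ≤ sB := hsB _ _ _ _ (hwb n hn)
  obtain ⟨g, hg⟩ : ∃ g, g = (α / (1 + α * ‖e n‖ ^ 2) * s) • e n := ⟨_, rfl⟩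
  have hstep : w (n + 1) = projBall R (w n + g) := by
    rw [hg, hs, he, hw, hαdef]; exact projImplicitTD_succ _ _ _ _ _ _ _ _ _ (by omega)
  have hδ : ‖w n - wstar‖ ≤ 2 * R := (norm_sub_le _ _).trans (by linarith [hwb n hn])
  have hsq : ‖w (n + 1) - wstar‖ ^ 2 ≤
      ‖w n - wstar‖ ^ 2 + 2 * α * (s * ⟪e n, w n - wstar⟫) + C₁ * α ^ 2 := by
    refine le_trans ?_ (norm_implicit_step_sub_sq_le hα.le hsb (heb n) hδ)
    rw [← hg, hstep]
    refine pow_le_pow_left₀ (norm_nonneg _) ((norm_projBall_sub_le hR _).trans (le_of_eq ?_)) 2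
    congr 1; abel
  have hmove : ‖w (n + 1) - w n‖ ≤ α * (sB * eB) := by
    rw [hstep]
    refine (norm_projBall_sub_le (hwb n hn) _).trans ?_
    rw [add_sub_cancel_left, hg]
    exact norm_implicit_step_le hα.le hsb (heb n)
  obtain ⟨hb, -⟩ := hBL (x (n + 1)) (e (n + 1)) (w (n + 1)) (heb _) (hwb _ (by omega))
  have hlip := (hBL (x (n + 1)) (e (n + 1)) (w n) (heb _) (hwb n hn)).2 (w (n + 1))
    (hwb _ (by omega))
  set Ψ' := corrector M π μ φ γ (lam * γ) wstar (x (n + 1)) (e (n + 1)) (w (n + 1))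
  set Ψ := corrector M π μ φ γ (lam * γ) wstar (x (n + 1)) (e (n + 1)) (w n)
  have h2 : α * (Ψ' - Ψ) ≤ L * (sB * eB) * α ^ 2 := by
    have : Ψ' - Ψ ≤ L * (α * (sB * eB)) :=
      (le_abs_self _).trans (hlip.trans (mul_le_mul_of_nonneg_left hmove hL0))
    nlinarith
  have h3 : (α' - α) * Ψ' ≤ l * (1 - κ) * B * α ^ 2 := by
    have hα'α : α' ≤ α := by nlinarith [mul_nonneg hc (mul_pos hα hα').le]
    calc (α' - α) * Ψ' = (l * (1 - κ) * (α * α')) * -Ψ' := by rw [← hdiff]; ring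
      _ ≤ (l * (1 - κ) * (α * α')) * B :=
          mul_le_mul_of_nonneg_left ((neg_le_abs _).trans hb)
            (mul_nonneg hc (mul_pos hα hα').le)
      _ ≤ (l * (1 - κ) * (α * α)) * B := by gcongr
      _ = _ := by ring
  nlinarith

end Lyapunov

/-! ### Convergence in mean square -/

section Convergence

variable {S A : Type*} [Fintype S] [DecidableEq S] [MeasurableSpace S] [DiscreteMeasurableSpace S]
    [Fintype A] [MeasurableSpace A] [DiscreteMeasurableSpace A]
    {d : ℕ} {Ω : Type*} [MeasurableSpace Ω] {Pr : Measure Ω} [IsProbabilityMeasure Pr]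

/-- In expectation, the corrected squared error contracts: averaging the temporal difference and
the corrector over `(a_n, x_{n+1})` turns the noise term of the one-step inequality into `Ψ_n` plus
the mean drift, which is at most `-c ‖w_n - w_*‖²`. -/
theorem exists_mean_sq_error_le (M : MDP S A) (π : Policy S A) {μ : S → ℝ}
    (hchain : IsErgodicChain (transition M π) μ)
    {φ : S → EuclideanSpace ℝ (Fin d)} (hφ : ∀ x, ‖φ x‖ ≤ 1)
    (hrank : (featureMatrix φ).rank = d) {γ lam : ℝ} (hγ : γ ∈ Set.Ioo (0 : ℝ) 1)
    (hlam : lam ∈ Set.Icc (0 : ℝ) 1) {X : ℕ → Ω → S} {Act : ℕ → Ω → A}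
    (hX : IsTrajectory M π μ Pr X Act) {wstar : EuclideanSpace ℝ (Fin d)}
    (hwstar : IsTDSolution M π μ φ γ lam wstar) {R : ℝ} (hR : ‖wstar‖ ≤ R) {α₁ : ℝ}
    (hα₁ : 0 < α₁) (hl : 0 < lamMin φ μ) (w₁ : EuclideanSpace ℝ (Fin d)) :
    ∃ C, ∀ N : ℕ, 2 ≤ N → ∫ ω, ‖projImplicitTD M.r φ γ lam R
      (stepSize α₁ (lamMin φ μ) (kappa γ lam)) w₁ (fun k => X k ω) (fun k => Act k ω) (N + 1) -
        wstar‖ ^ 2 ∂Pr ≤ C / N := by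
  have h0 : 0 ≤ lam * γ := mul_nonneg hlam.1 hγ.1.le
  have h1 : lam * γ < 1 := by nlinarith [hlam.1, hlam.2, hγ.1, hγ.2]
  have hκ : kappa γ lam < 1 := by
    rw [kappa, div_lt_one (by linarith)]
    nlinarith [hγ.2]
  have hc : 0 < lamMin φ μ * (1 - kappa γ lam) := mul_pos hl (sub_pos.2 hκ)
  obtain ⟨B, C, hB0, hC0, hstep⟩ := exists_lyapunov_step M π μ hφ hγ h0 h1 hR hα₁ hc.le w₁
  have hdrift := meanDrift_le M π φ hchain hrank hγ hlam hwstar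
  have hα := fun n => stepSize_pos (n := n) hα₁ hc.le
  have hcα := fun n => mul_stepSize_le (n := n) hα₁ hc.le
  have hrec := fun C hC V => exists_le_mul_stepSize hα₁ hc (C := C) hC (V := V)
  set c := lamMin φ μ * (1 - kappa γ lam)
  set α := stepSize α₁ (lamMin φ μ) (kappa γ lam)
  set w : ℕ → Ω → EuclideanSpace ℝ (Fin d) := fun n ω =>
    projImplicitTD M.r φ γ lam R α w₁ (fun k => X k ω) (fun k => Act k ω) n with hw
  set e : ℕ → Ω → EuclideanSpace ℝ (Fin d) := fun n ω => trace φ γ lam (fun k => X k ω) n with he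
  set Ψ := corrector M π μ φ γ (lam * γ) wstar with hΨ
  have hfw : ∀ n, Function.FactorsThrough (w n) (history X Act n) := fun n ω ω' h =>
    projImplicitTD_congr _ _ _ _ _ _ _ h
  have hfe : ∀ n, Function.FactorsThrough (e n) (history X Act n) := fun n ω ω' h =>
    trace_congr (pathData_eq_iff.1 h).1
  have hfX : ∀ n i, 1 ≤ i → i ≤ n → Function.FactorsThrough (X i) (history X Act n) :=
    fun n i hi hn ω ω' h => (pathData_eq_iff.1 h).1 i (Finset.mem_Icc.2 ⟨hi, hn⟩)
  have hfA : ∀ n i, 1 ≤ i → i < n → Function.FactorsThrough (Act i) (history X Act n) :=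
    fun n i hi hn ω ω' h => (pathData_eq_iff.1 h).2 i (Finset.mem_Ico.2 ⟨hi, hn⟩)
  have hmono : ∀ n ω ω', history X Act (n + 1) ω = history X Act (n + 1) ω' →
      history X Act n ω = history X Act n ω' := fun n ω ω' h => by
    rw [history, history, pathData_eq_iff] at *
    refine ⟨fun i hi => h.1 i ?_, fun i hi => h.2 i ?_⟩ <;>
      simp only [Finset.mem_Icc, Finset.mem_Ico] at hi ⊢ <;> omega
  have hiw : ∀ n, Integrable (fun ω => ‖w n ω - wstar‖ ^ 2) Pr := fun n =>
    hX.integrable (n := n) fun ω ω' h => by simp only [hfw n h]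
  have hiΨ : ∀ n, 1 ≤ n → Integrable (fun ω => Ψ (X n ω) (e n ω) (w n ω)) Pr := fun n hn =>
    hX.integrable (n := n) fun ω ω' h => by simp only [hfw n h, hfe n h, hfX n n hn le_rfl h]
  set H : S × EuclideanSpace ℝ (Fin d) × EuclideanSpace ℝ (Fin d) → A → S → ℝ := fun p b z =>
    tdError M.r φ γ p.2.1 p.1 b z * ⟪p.2.2, p.2.1 - wstar⟫ +
      Ψ z (φ z + (lam * γ) • p.2.2) p.2.1 with hH
  have hiH : ∀ n, 1 ≤ n →
      Integrable (fun ω => H (X n ω, w n ω, e n ω) (Act n ω) (X (n + 1) ω)) Pr := fun n hn =>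
    hX.integrable (n := n + 1) fun ω ω' h => by
      simp only [hfw n (hmono n _ _ h), hfe n (hmono n _ _ h), hfX (n + 1) n hn (by omega) h,
        hfX (n + 1) (n + 1) (by omega) le_rfl h, hfA (n + 1) n hn (by omega) h]
  set Z : ℕ → ℝ := fun n => ∫ ω, ‖w n ω - wstar‖ ^ 2 ∂Pr with hZ
  set p : ℕ → ℝ := fun n => ∫ ω, Ψ (X n ω) (e n ω) (w n ω) ∂Pr with hp
  have hpB : ∀ n, 2 ≤ n → |p n| ≤ B := fun n hn => by
    have := norm_integral_le_of_norm_le_const (μ := Pr) (C := B)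
      (f := fun ω => Ψ (X n ω) (e n ω) (w n ω))
      (Eventually.of_forall fun ω => (hstep _ _ _ _ rfl rfl n hn).1)
    simpa using this
  have hHp : ∀ n, 1 ≤ n →
      ∫ ω, H (X n ω, w n ω, e n ω) (Act n ω) (X (n + 1) ω) ∂Pr ≤ p n - c * Z n := by
    intro n hn
    rw [hX.integral_step hn (Y := fun ω => (X n ω, w n ω, e n ω)) (fun ω ω' h => by
      simp only [hfw n h, hfe n h, hfX n n hn le_rfl h]) H, hZ, hp]
    simp only
    rw [← integral_const_mul, ← integral_sub (hiΨ n hn) ((hiw n).const_mul c)]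
    have hav : ∀ ω, ∑ b, ∑ z, π.prob (X n ω) b * M.P b (X n ω) z * H (X n ω, w n ω, e n ω) b z =
        Ψ (X n ω) (e n ω) (w n ω) + meanDrift M π μ φ γ (lam * γ) wstar (w n ω) := by
      intro ω
      rw [← corrector_poisson M π φ hchain h0 h1 wstar (X n ω) (e n ω) (w n ω), ← sum_tdError,
        ← sum_prob_mul_P_mul]
      simp only [hH, hΨ, mul_add, Finset.sum_add_distrib, Finset.sum_mul, mul_assoc]
    simp only [hav]
    refine integral_mono (hX.integrable (n := n) fun ω ω' h => by
      simp only [hfw n h, hfe n h, hfX n n hn le_rfl h])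
      ((hiΨ n hn).sub ((hiw n).const_mul c)) fun ω => ?_
    have := hdrift (w n ω)
    simp only
    linarith
  have hV : ∀ n, 2 ≤ n → Z (n + 1) + 2 * α (n + 1) * p (n + 1) ≤
      (1 - 2 * c * α n) * (Z n + 2 * α n * p n) + (C + 4 * c * B) * α n ^ 2 := by
    intro n hn
    have hint : Z (n + 1) + 2 * α (n + 1) * p (n + 1) ≤
        Z n + 2 * α n * ∫ ω, H (X n ω, w n ω, e n ω) (Act n ω) (X (n + 1) ω) ∂Pr +
          C * α n ^ 2 := by
      have i1 := (hiΨ (n + 1) (by omega)).const_mul (2 * α (n + 1))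
      have i2 := (hiH n (by omega)).const_mul (2 * α n)
      have := integral_mono ((hiw (n + 1)).add i1)
        (((hiw n).add i2).add (integrable_const (C * α n ^ 2)))
        fun ω => (hstep (fun k => X k ω) (fun k => Act k ω) _ _ rfl rfl n hn).2
      rw [integral_add' (hiw _) i1, integral_add' ((hiw _).add i2) (integrable_const _),
        integral_add' (hiw _) i2, integral_const_mul, integral_const_mul, integral_const] at this
      simpa using this
    have hαn := hα n (by omega)
    have h2 := mul_le_mul_of_nonneg_left (hHp n (by omega)) (mul_pos two_pos hαn).le
    have h3 := (abs_le.1 (hpB n hn)).2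
    have h4 : 0 ≤ 4 * c * α n ^ 2 := by positivity
    nlinarith [mul_le_mul_of_nonneg_left h3 h4]
  obtain ⟨D, hD0, hD⟩ := hrec (C + 4 * c * B) (by positivity)
    (fun n => Z n + 2 * α n * p n) hV
  refine ⟨(D + 2 * B) / c, fun N hN => ?_⟩
  have hN0 : (0 : ℝ) < N := by exact_mod_cast (show 0 < N by omega)
  have hV' : Z (N + 1) + 2 * α (N + 1) * p (N + 1) ≤ D * α (N + 1) := hD (N + 1) (by omega)
  have hαN := hα (N + 1) (by omega)
  have h3 := (abs_le.1 (hpB (N + 1) (by omega))).1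
  have hZN : Z (N + 1) ≤ (D + 2 * B) * α (N + 1) := by
    nlinarith
  refine hZN.trans ?_
  have hαle : α (N + 1) ≤ 1 / (c * N) := by
    rw [le_div_iff₀ (by positivity)]
    linarith [hcα N (by omega)]
  calc (D + 2 * B) * α (N + 1) ≤ (D + 2 * B) * (1 / (c * N)) := by gcongr
    _ = (D + 2 * B) / c / N := by field_simp

end Convergence

end ImplicitTD

theorem theorem5
    {S A : Type*} [Fintype S] [DecidableEq S] [MeasurableSpace S] [DiscreteMeasurableSpace S]
    [Fintype A] [MeasurableSpace A] [DiscreteMeasurableSpace A]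
    {d : ℕ} {Ω : Type*} [MeasurableSpace Ω] (Pr : Measure Ω) [IsProbabilityMeasure Pr]
    -- the decision process, the policy that generates the data, and its steady state
    (M : ImplicitTD.MDP S A) (π : ImplicitTD.Policy S A) (μ : S → ℝ)
    (hchain : ImplicitTD.IsErgodicChain (ImplicitTD.transition M π) μ)
    -- normalized features of full column rank
    (φ : S → EuclideanSpace ℝ (Fin d)) (hφ : ∀ x, ‖φ x‖ ≤ 1)
    (hrank : (ImplicitTD.featureMatrix φ).rank = d)
    -- discount factor and trace-decay parameter
    (γ lam : ℝ) (hγ : γ ∈ Set.Ioo (0 : ℝ) 1) (hlam : lam ∈ Set.Icc (0 : ℝ) 1)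
    -- the observed stationary trajectory
    (X : ℕ → Ω → S) (Act : ℕ → Ω → A) (hX : ImplicitTD.IsTrajectory M π μ Pr X Act)
    -- the limit point, the projection radius, the step sizes, the initial guess, the iterates
    (wstar : EuclideanSpace ℝ (Fin d)) (hwstar : ImplicitTD.IsTDSolution M π μ φ γ lam wstar)
    (R : ℝ) (hR : ‖wstar‖ ≤ R) (α₁ : ℝ) (hα₁ : 0 < α₁)
    (α : ℕ → ℝ)
    (hα : α = ImplicitTD.stepSize α₁ (ImplicitTD.lamMin φ μ) (ImplicitTD.kappa γ lam))
    (w₁ : EuclideanSpace ℝ (Fin d)) (w : ℕ → Ω → EuclideanSpace ℝ (Fin d))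
    (hw : ∀ n ω, w n ω = ImplicitTD.projImplicitTD M.r φ γ lam R α w₁
      (fun k => X k ω) (fun k => Act k ω) n) :
    -- the mean squared errors are genuine (finite) expectations
    (∀ N : ℕ, Integrable (fun ω => ‖w (N + 1) ω - wstar‖ ^ 2) Pr) ∧
    -- constants of geometric mixing, which enter the mixing time, exist
    (∃ m ρ : ℝ, ImplicitTD.IsMixingPair (ImplicitTD.transition M π) μ m ρ) ∧
    -- the error is `1 / N` up to a constant and a power of `log N`
    (∃ (C : ℝ) (k : ℕ), ∀ m ρ : ℝ,
      ImplicitTD.IsMixingPair (ImplicitTD.transition M π) μ m ρ →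
      ∀ N : ℕ, 2 * ImplicitTD.mixingTime m ρ (α N) < N →
        ∫ ω, ‖w (N + 1) ω - wstar‖ ^ 2 ∂Pr ≤ C * Real.log N ^ k / N) ∧
    -- the error tends to zero
    Tendsto (fun N : ℕ => ∫ ω, ‖w (N + 1) ω - wstar‖ ^ 2 ∂Pr) atTop (𝓝 0) := by
  have hK := ImplicitTD.transition_mem_rowStochastic M π
  have hbound : ∃ C, ∀ N : ℕ, 2 ≤ N → ∫ ω, ‖w (N + 1) ω - wstar‖ ^ 2 ∂Pr ≤ C / N := by
    rcases Nat.eq_zero_or_pos d with rfl | hd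
    · refine ⟨0, fun N _ => ?_⟩
      have : ∀ ω, w (N + 1) ω - wstar = 0 := fun ω => Subsingleton.elim _ _
      simp [this]
    · have : NeZero d := ⟨hd.ne'⟩
      simp only [hw, hα]
      exact ImplicitTD.exists_mean_sq_error_le M π hchain hφ hrank hγ hlam hX hwstar hR hα₁
        (ImplicitTD.lamMin_pos hchain.pos hrank) w₁
  obtain ⟨C, hC⟩ := hbound
  have hnonneg : ∀ N, 0 ≤ ∫ ω, ‖w (N + 1) ω - wstar‖ ^ 2 ∂Pr := fun N =>
    integral_nonneg fun ω => by positivity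
  refine ⟨fun N => ?_, hchain.exists_isMixingPair hK, ⟨C, 0, fun m ρ hmρ N hN => ?_⟩, ?_⟩
  · refine hX.integrable (n := N + 1) fun ω ω' h => ?_
    simp only [hw]
    rw [ImplicitTD.projImplicitTD_congr M.r φ γ lam R α w₁ h]
  · rw [pow_zero, mul_one]
    have hN1 : 1 ≤ N := by omega
    have hlam0 : 0 ≤ ImplicitTD.lamMin φ μ := by
      rcases Nat.eq_zero_or_pos d with rfl | hd
      · -- for `d = 0` the spectrum is empty, so that `lamMin` is zero
        rw [ImplicitTD.lamMin, spectrum.of_subsingleton, Real.sInf_empty]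
      · have : NeZero d := ⟨hd.ne'⟩
        exact (ImplicitTD.lamMin_pos hchain.pos hrank).le
    have hκ : ImplicitTD.kappa γ lam ≤ 1 := by
      have : lam * γ < 1 := by nlinarith [hlam.1, hlam.2, hγ.1, hγ.2]
      rw [ImplicitTD.kappa, div_le_one (by linarith)]
      nlinarith [hγ.2]
    have hαN : 0 < α N := by
      rw [hα]; exact ImplicitTD.stepSize_pos hα₁ (mul_nonneg hlam0 (sub_nonneg.2 hκ)) hN1
    -- the mixing time is a minimum over a nonempty set of positive integers, whence `N ≥ 3`
    have hτ : 1 ≤ ImplicitTD.mixingTime m ρ (α N) := by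
      have hne : {n : ℕ | 1 ≤ n ∧ m * ρ ^ n ≤ α N}.Nonempty := by
        have ht := (tendsto_pow_atTop_nhds_zero_of_lt_one hmρ.ρ_pos.le hmρ.ρ_lt_one).const_mul m
        rw [mul_zero] at ht
        obtain ⟨n, h1, h2⟩ := ((eventually_ge_atTop 1).and (ht.eventually_le_const hαN)).exists
        exact ⟨n, h1, h2⟩
      exact (Nat.sInf_mem hne).1
    exact hC N (by omega)
  · refine squeeze_zero' (Eventually.of_forall hnonneg)
      ((eventually_ge_atTop 2).mono hC) (tendsto_const_div_atTop_nhds_zero_nat C)
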